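/- Let $w,\mu>0$ and $L\ge 2$. On the torus $\mathbb T_L=\mathbb Z/L\mathbb Z$ consider diffusion-limited pair annihilation and deposition together with its activity $A(t)$, that is, the Markov chain $(\eta(t),A(t))$ on $\{0,1\}^{L}\times\mathbb N_0$ with generator $$(\tilde{\mathcal H}f)(\eta,A)=\sum_{k=0}^{L-1}\Big[\mu f(\bar\eta^{k,k+1},A)+w(\eta_k+\eta_{k+1})f(\bar\eta^{k,k+1},A+1)-\big(\mu+w(\eta_k+\eta_{k+1})\big)f(\eta,A)\Big],$$ where $\bar\eta^{k,k+1}$ is $\eta$ with the occupation numbers at the sites $k$ and $k+1$ flipped, and $A(0)=0$. Take $w=\tfrac12$ and $\mu=\tfrac12(1-\nu)$ with $\nu\in[0,1)$, so that $\nu=1-\mu/w$. Then for all $L\ge 2$ and $s\in\mathbb R$ the limit $$K_L(s)=\lim_{t\to\infty}\frac1{Lt}\ln \mathbb E_{\eta,0}\big[e^{sA(t)}\big]$$ exists and is the same for all initial configurations $\eta$ with an even number of particles, and $K_L$ is twice continuously differentiable. Let $V^{c}(L)=K_L''(s_c)$ be the second cumulant (the variance of the activity) at the critical point $s_c=\ln(1-\mu/w)=\ln\nu$;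 for $\nu=0$, where $s_c=-\infty$, the limit $V^{c}(L)=\lim_{s\to-\infty}K_L''(s)$ exists for every $L\ge2$ and is taken as the definition. As $L\to\infty$, $$V^{c}(L)\sim\frac{\nu^{2}}{2\pi\sqrt{1-\nu^{2}}}\,\ln L ,$$ where $f\sim g$ means $f-g=o(g)$ (so that for $\nu=0$ it says that $V^{c}(L)=0$ for all large $L$). In particular, $V^{c}(L)\to\infty$ logarithmically for $0<\nu<1$. -/

import Mathlib

open Filter Topology Asymptotics

noncomputable section

namespace DLPAD

/-- Configurations on the torus with `L` sites: `η k = true` means that site `k` is occupied. -/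
abbrev Config (L : ℕ) : Type := Fin L → Bool

/-- State space of the joint process: configuration and number of jumps so far. -/
abbrev State (L : ℕ) : Type := Config L × ℕ

/-- The right neighbour `k + 1` (modulo `L`) of the site `k`. -/
def next {L : ℕ} (k : Fin L) : Fin L :=
  ⟨(k.val + 1) % L, Nat.mod_lt _ (Nat.lt_of_le_of_lt (Nat.zero_le _) k.isLt)⟩

/-- The configuration `η` with the occupations of `k` and `k + 1` flipped. -/
def flipBond {L : ℕ} (k : Fin L) (η : Config L) : Config L :=
  fun j => if j = k ∨ j = next k then !(η j) else η j

/-- Occupation number, as a real number. -/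
def occ {L : ℕ} (η : Config L) (k : Fin L) : ℝ := if η k = true then 1 else 0

/-- Total particle number. -/
def numParticles {L : ℕ} (η : Config L) : ℕ := (Finset.univ.filter fun k => η k = true).card

/-- Generator of the joint process (configuration, activity): at every bond `(k, k + 1)` both
occupations are flipped with rate `μ` without changing the activity (deposition), and with rate
`w (η_k + η_{k+1})` with an increase of the activity by one (particle jump). -/
def generator (w μ : ℝ) (L : ℕ) : Module.End ℝ (State L → ℝ) where
  toFun f := fun x =>
    ∑ k : Fin L, (μ * f (flipBond k x.1, x.2)
      + w * (occ x.1 k + occ x.1 (next k)) * f (flipBond k x.1, x.2 + 1)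
      - (μ + w * (occ x.1 k + occ x.1 (next k))) * f x)
  map_add' f g := by
    funext x
    simp only [Pi.add_apply, ← Finset.sum_add_distrib]
    exact Finset.sum_congr rfl fun k _ => by ring
  map_smul' c f := by
    funext x
    simp only [Pi.smul_apply, smul_eq_mul, RingHom.id_apply, Finset.mul_sum]
    exact Finset.sum_congr rfl fun k _ => by ring

/-- The Markov semigroup `exp (t * generator)`. Since all rates are bounded, for bounded `f` it is
given by the exponential series, which converges uniformly, and `semigroup w μ L t f x` is the
expectation of `f` at time `t` for the joint process started in the state `x`. -/
def semigroup (w μ : ℝ) (L : ℕ) (t : ℝ) (f : State L → ℝ) (x : State L) : ℝ :=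
  ∑' n : ℕ, t ^ n / (n.factorial : ℝ) * ((generator w μ L) ^ n) f x

/-- Probability that the activity satisfies `A(t) = a`, for the process started from the
configuration `η` with `A(0) = 0`. -/
def activityProb (w μ : ℝ) (L : ℕ) (η : Config L) (t : ℝ) (a : ℕ) : ℝ :=
  semigroup w μ L t (fun x => if x.2 = a then 1 else 0) (η, 0)

/-- Moment generating function `E[exp (s A(t))]` of the activity, started from `η`. -/
def activityMGF (w μ : ℝ) (L : ℕ) (η : Config L) (s t : ℝ) : ℝ :=
  ∑' a : ℕ, activityProb w μ L η t a * Real.exp (s * a)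

/-- `K` is the long-time cumulant generating function (per site and unit time) of the activity in
the even sector: `K s = lim_{t → ∞} log E[exp (s A(t))] / (L t)` for every initial configuration
with an even number of particles. -/
def IsEvenCGF (w μ : ℝ) (L : ℕ) (K : ℝ → ℝ) : Prop :=
  ∀ (s : ℝ) (η : Config L), Even (numParticles η) →
    Tendsto (fun t : ℝ => Real.log (activityMGF w μ L η s t) / (L * t)) atTop (𝓝 (K s))

end DLPAD

end

/-!
On configurations with an even number of particles, the Jordan–Wigner transformation turns the
generator tilted by `z = exp s` into a quadratic form in free fermions with antiperiodic momenta
`q`. This operator has an explicit Gaussian eigenvector `exp (½ ∑ G_{jk} c_j† c_k†) |0⟩`, because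
the pairing matrix `G` solves a matrix Riccati equation, which decouples in momentum space; its
eigenvalue is `-L (μ + w)` plus half the sum of the energies `√E_q(z)`. At `s = 0` the eigenvector
is the constant function, and it stays positive on the even sector for all `s`: a nonnegative
eigenvector cannot vanish at a single configuration, so positivity is both an open and a closed
condition on `s`. A positive eigenvector fixes the exponential growth rate of the moment
generating function, hence `K_L` is the eigenvalue divided by `L`.

At the critical point `z = ν` the gap closes as `q → 0`: there
`E_q = 4 w² u (2 (1 - ν²) + ν² u)` with `u = 1 - cos q = 2 sin² (q / 2)`, and the second derivative
of `√E_q` in `s` equals a constant multiple of `1 / sin (q / 2)` up to a bounded error. Averaged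
over the momenta `(2 j + 1) π / L` this is a harmonic sum, which produces `log L`.
-/

noncomputable section

namespace DLPAD

section QuadraticForms

variable {R A ι : Type*} [CommRing R] [Ring A] [Algebra R A] [Fintype ι]

/-- The linear combinations `∑ y, M x y • b y` of a family `b`: the action of the matrix `M` on
column vectors with entries in the algebra `A`. -/
def linComb (M : Matrix ι ι R) (b : ι → A) (x : ι) : A := ∑ y, M x y • b y

/-- The quadratic form `∑ x y, M x y • (a x * b y)` in two families of operators, as a linear
function of its coefficient matrix. -/
def quadForm (a b : ι → A) : Matrix ι ι R →ₗ[R] A where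
  toFun M := ∑ x, ∑ y, M x y • (a x * b y)
  map_add' M N := by simp [add_smul, Finset.sum_add_distrib]
  map_smul' r M := by simp [Finset.smul_sum, smul_smul]

lemma quadForm_apply (a b : ι → A) (M : Matrix ι ι R) :
    quadForm a b M = ∑ x, ∑ y, M x y • (a x * b y) := rfl

lemma quadForm_eq_sum_mul_linComb (a b : ι → A) (M : Matrix ι ι R) :
    quadForm a b M = ∑ x, a x * linComb M b x := by
  simp only [quadForm_apply, linComb, Finset.mul_sum, mul_smul_comm]

lemma linComb_neg (M : Matrix ι ι R) (b : ι → A) (x : ι) : linComb (-M) b x = -linComb M b x := by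
  simp [linComb]

lemma quadForm_linComb_right (a b : ι → A) (M N : Matrix ι ι R) :
    quadForm a (linComb N b) M = quadForm a b (M * N) := by
  simp only [quadForm_eq_sum_mul_linComb, linComb, Matrix.mul_apply, Finset.smul_sum,
    Finset.sum_smul, smul_smul]
  exact Finset.sum_congr rfl fun x _ => congrArg (a x * ·) Finset.sum_comm

lemma quadForm_smul_congr {E : Type*} [AddCommGroup E] [Module A E] {b b' : ι → A} {ψ : E}
    (h : ∀ y, b y • ψ = b' y • ψ) (a : ι → A) (M : Matrix ι ι R) :
    quadForm a b M • ψ = quadForm a b' M • ψ := by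
  simp only [quadForm_apply, Finset.sum_smul, ← smul_mul_assoc, mul_smul, h]

end QuadraticForms

section CAR

/-- The canonical anticommutation relations for annihilation operators `c` and creation operators
`d`, without those among annihilation operators alone, which play no role for Gaussian states. -/
structure IsCAR {A ι : Type*} [Ring A] [DecidableEq ι] (c d : ι → A) : Prop where
  creat_mul_creat : ∀ j k, d j * d k = -(d k * d j)
  annih_mul_creat : ∀ j k, c j * d k = (if j = k then 1 else 0) - d k * c j

namespace IsCAR

variable {R A ι : Type*} [Ring A] [Fintype ι] [DecidableEq ι] {c d : ι → A}

section Algebra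

variable [CommRing R] [Algebra R A]

lemma commute_quadForm_creat (h : IsCAR c d) (M : Matrix ι ι R) (k : ι) :
    Commute (quadForm d d M) (d k) := by
  refine Commute.sum_left _ _ _ fun x _ => Commute.sum_left _ _ _ fun y _ => Commute.smul_left ?_ _
  rw [Commute, SemiconjBy, mul_assoc, h.creat_mul_creat y k, mul_neg, ← mul_assoc,
    h.creat_mul_creat x k, neg_mul, neg_neg, mul_assoc]

lemma commute_quadForm_linComb (h : IsCAR c d) (M N : Matrix ι ι R) (k : ι) :
    Commute (quadForm d d M) (linComb N d k) :=
  Commute.sum_right _ _ _ fun _ _ => (h.commute_quadForm_creat M _).smul_right _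

lemma quadForm_annih_creat (h : IsCAR c d) (M : Matrix ι ι R) :
    quadForm c d M = M.trace • 1 - quadForm d c M.transpose := by
  have hdc : quadForm d c M.transpose = ∑ x, ∑ y, M x y • (d y * c x) := Finset.sum_comm
  have htrace : ∑ x, ∑ y, M x y • (if x = y then (1 : A) else 0) = M.trace • 1 := by
    simp [Matrix.trace, Finset.sum_smul]
  simp only [hdc, ← htrace, quadForm_apply, h.annih_mul_creat, smul_sub, Finset.sum_sub_distrib]

lemma annih_mul_linComb (h : IsCAR c d) (M : Matrix ι ι R) (j k : ι) :
    c j * linComb M d k = M k j • 1 - linComb M d k * c j := by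
  simp only [linComb, Finset.mul_sum, Finset.sum_mul, mul_smul_comm, smul_mul_assoc,
    h.annih_mul_creat, smul_sub, Finset.sum_sub_distrib]
  simp

lemma annih_mul_quadForm (h : IsCAR c d) {G : Matrix ι ι R} (hG : G.transpose = -G) (k : ι) :
    c k * quadForm d d G = quadForm d d G * c k + (2 : R) • linComb G d k := by
  have hterm (x : ι) : c k * (d x * linComb G d x) = d x * linComb G d x * c k
      + ((if k = x then linComb G d x else 0) - G x k • d x) := by
    rw [← mul_assoc, h.annih_mul_creat, sub_mul, ite_mul, one_mul, zero_mul, mul_assoc,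
      h.annih_mul_linComb, mul_sub, mul_smul_comm, mul_one, mul_assoc]
    abel
  have hcol : ∑ x, G x k • d x = -linComb G d k := by
    rw [← linComb_neg, ← hG]
    rfl
  simp only [quadForm_eq_sum_mul_linComb, Finset.mul_sum, Finset.sum_mul, hterm,
    Finset.sum_add_distrib, Finset.sum_sub_distrib, hcol, Finset.sum_ite_eq, Finset.mem_univ,
    if_true, sub_neg_eq_add, two_smul]

lemma quadForm_smul_of_annih_smul_eq {E : Type*} [AddCommGroup E] [Module R E] [Module A E]
    [IsScalarTower R A E] (h : IsCAR c d) {G : Matrix ι ι R} (hG : G.transpose = -G) {ψ : E}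
    (hψ : ∀ k, c k • ψ = linComb G d k • ψ) (M N P : Matrix ι ι R) :
    (quadForm d c M + quadForm d d N + quadForm c c P) • ψ =
      quadForm d d (M * G + N + G * P.transpose * G) • ψ + (P * G).trace • ψ := by
  have hdc (Q : Matrix ι ι R) : quadForm d c Q • ψ = quadForm d d (Q * G) • ψ := by
    rw [quadForm_smul_congr hψ, quadForm_linComb_right]
  have hcc : quadForm c c P • ψ = quadForm c d (P * G) • ψ := by
    rw [quadForm_smul_congr hψ, quadForm_linComb_right]
  rw [add_smul, add_smul, hdc, hcc, h.quadForm_annih_creat, sub_smul, hdc, Matrix.transpose_mul,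
    hG, smul_assoc, one_smul, neg_mul, neg_mul, map_neg, map_add, map_add, add_smul, add_smul,
    neg_smul]
  abel

end Algebra

lemma quadForm_eq_zero_of_isSymm [Field R] [NeZero (2 : R)] [Algebra R A] (h : IsCAR c d)
    {M : Matrix ι ι R} (hM : M.IsSymm) : quadForm d d M = 0 := by
  have hneg : quadForm d d M = -quadForm d d M := by
    conv_lhs => rw [quadForm_apply, Finset.sum_comm]
    simp only [quadForm_apply, ← Finset.sum_neg_distrib, ← smul_neg, ← h.creat_mul_creat,
      fun x y => hM.apply y x]
  have htwo : (2 : R) • quadForm d d M = 0 := by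
    rw [two_smul]
    exact eq_neg_iff_add_eq_zero.1 hneg
  exact (smul_eq_zero_iff_right two_ne_zero).1 htwo

end IsCAR

end CAR

section Exponential

variable {A : Type*}

lemma mul_pow_of_mul_eq [Ring A] {c P B : A} (h : c * P = P * c + B) (hB : Commute P B) (n : ℕ) :
    c * P ^ (n + 1) = P ^ (n + 1) * c + (n + 1 : ℕ) • (P ^ n * B) := by
  induction n with
  | zero => simpa using h
  | succ n ih =>
    rw [pow_succ P (n + 1), ← mul_assoc, ih, add_mul, mul_assoc, h, mul_add, smul_mul_assoc,
      mul_assoc, ← hB.eq, ← mul_assoc (P ^ n), ← pow_succ, succ_nsmul (P ^ (n + 1) * B) (n + 1),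
      ← mul_assoc, add_assoc, add_comm (P ^ (n + 1) * B)]

lemma mul_exp_of_mul_eq (𝕜 : Type*) [RCLike 𝕜] [NormedRing A] [NormedAlgebra 𝕜 A] [CompleteSpace A]
    {c P B : A} (h : c * P = P * c + B) (hB : Commute P B) :
    c * NormedSpace.exp P = NormedSpace.exp P * c + B * NormedSpace.exp P := by
  have hexp := NormedSpace.exp_series_hasSum_exp' (𝕂 := 𝕜) P
  have hcommutator := (hexp.mul_left c).sub (hexp.mul_right c)
  have hderivative : HasSum (fun n : ℕ => c * ((n.factorial : 𝕜)⁻¹ • P ^ n)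
      - ((n.factorial : 𝕜)⁻¹ • P ^ n) * c) (B * NormedSpace.exp P) := by
    rw [← hasSum_nat_add_iff' 1]
    simp only [Finset.range_one, Finset.sum_singleton, pow_zero, Nat.factorial_zero, Nat.cast_one,
      inv_one, one_smul, mul_one, one_mul, sub_self, sub_zero]
    refine (congrArg (HasSum · _) (funext fun n => ?_)).mpr (hexp.mul_left B)
    have hn : ((n + 1 : ℕ) : 𝕜) ≠ 0 := Nat.cast_ne_zero.2 n.succ_ne_zero
    rw [mul_smul_comm, mul_pow_of_mul_eq h hB, smul_add, smul_mul_assoc, add_sub_cancel_left,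
      mul_smul_comm, ← (hB.pow_left n).eq, ← Nat.cast_smul_eq_nsmul 𝕜, smul_smul,
      Nat.factorial_succ, Nat.cast_mul, mul_inv_rev, mul_assoc, inv_mul_cancel₀ hn, mul_one]
  rw [← sub_eq_iff_eq_add', hcommutator.unique hderivative]

lemma mul_exp_of_mul_eq_zero (𝕜 : Type*) [RCLike 𝕜] [NormedRing A] [NormedAlgebra 𝕜 A]
    [CompleteSpace A] {p P : A} (h : p * P = 0) : p * NormedSpace.exp P = p := by
  have hexp := (NormedSpace.exp_series_hasSum_exp' (𝕂 := 𝕜) P).mul_left p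
  refine (hexp.unique (hasSum_single 0 fun n hn => ?_)).trans (by simp)
  rw [mul_smul_comm, ← Nat.succ_pred_eq_of_ne_zero hn, pow_succ', ← mul_assoc, h, zero_mul,
    smul_zero]

end Exponential

section GaussianStates

variable {𝕜 A ι : Type*} [RCLike 𝕜] [NormedRing A] [NormedAlgebra 𝕜 A] [CompleteSpace A] [Fintype ι]

/-- The exponential `exp (½ ∑ x y, G x y • d x * d y)` which creates a Gaussian fermionic state with
pairing matrix `G` from the vacuum. -/
def gaussOp (d : ι → A) (G : Matrix ι ι 𝕜) : A :=
  NormedSpace.exp ((2⁻¹ : 𝕜) • quadForm d d G)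

lemma continuous_gaussOp (d : ι → A) : Continuous (gaussOp d : Matrix ι ι 𝕜 → A) := by
  have hform : Continuous fun G : Matrix ι ι 𝕜 => (2⁻¹ : 𝕜) • quadForm d d G := by
    simp only [quadForm_apply]
    fun_prop
  let _ : NormedAlgebra ℚ A := NormedAlgebra.restrictScalars ℚ 𝕜 _
  exact NormedSpace.exp_continuous.comp hform

lemma mul_gaussOp_of_mul_eq_zero {p : A} {d : ι → A} (h : ∀ k, p * d k = 0) (G : Matrix ι ι 𝕜) :
    p * gaussOp d G = p := by
  refine mul_exp_of_mul_eq_zero 𝕜 ?_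
  simp [quadForm_apply, Finset.mul_sum, ← mul_assoc, h]

variable [DecidableEq ι] {c d : ι → A}

lemma IsCAR.annih_mul_gaussOp (h : IsCAR c d) {G : Matrix ι ι 𝕜} (hG : G.transpose = -G) (k : ι) :
    c k * gaussOp d G = gaussOp d G * c k + linComb G d k * gaussOp d G := by
  refine mul_exp_of_mul_eq 𝕜 ?_ ((h.commute_quadForm_linComb G G k).smul_left _)
  rw [mul_smul_comm, h.annih_mul_quadForm hG, smul_add, smul_smul, inv_mul_cancel₀ two_ne_zero,
    one_smul, smul_mul_assoc]

/-- The symmetry condition is the matrix Riccati equation for the pairing matrix `G`. -/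
theorem IsCAR.quadForm_smul_gaussOp_smul {E : Type*} [AddCommGroup E] [Module 𝕜 E] [Module A E]
    [IsScalarTower 𝕜 A E] (h : IsCAR c d) {v : E} (hv : ∀ k, c k • v = 0) {G : Matrix ι ι 𝕜}
    (hG : G.transpose = -G) {M N P : Matrix ι ι 𝕜}
    (hRiccati : (M * G + N + G * P.transpose * G).IsSymm) :
    (quadForm d c M + quadForm d d N + quadForm c c P) • gaussOp d G • v =
      (P * G).trace • gaussOp d G • v := by
  have hannih (k : ι) : c k • gaussOp d G • v = linComb G d k • gaussOp d G • v := by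
    rw [← mul_smul, h.annih_mul_gaussOp hG, add_smul, mul_smul, hv, smul_zero, zero_add, mul_smul]
  rw [h.quadForm_smul_of_annih_smul_eq hG hannih, h.quadForm_eq_zero_of_isSymm hRiccati, zero_smul,
    zero_add]

end GaussianStates

section JordanWigner

variable {ι : Type*} [LinearOrder ι]

/-- The configuration with the occupation of the single site `k` flipped. -/
def flipSite (k : ι) (η : ι → Bool) : ι → Bool := Function.update η k (!(η k))

@[simp] lemma flipSite_same (k : ι) (η : ι → Bool) : flipSite k η k = !(η k) := by
  simp [flipSite]

lemma flipSite_of_ne {j k : ι} (h : j ≠ k) (η : ι → Bool) : flipSite k η j = η j := by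
  simp [flipSite, h]

@[simp] lemma flipSite_flipSite (k : ι) (η : ι → Bool) : flipSite k (flipSite k η) = η := by
  simp [flipSite]

lemma flipSite_comm (j k : ι) (η : ι → Bool) :
    flipSite j (flipSite k η) = flipSite k (flipSite j η) := by
  rcases eq_or_ne j k with rfl | h
  · rfl
  · simp [flipSite, h, h.symm, Function.update_comm h]

/-- The sign `(-1)^n` of an occupation number `n`. -/
def occSign (b : Bool) : ℂ := if b then -1 else 1

@[simp] lemma occSign_not (b : Bool) : occSign (!b) = -occSign b := by cases b <;> simp [occSign]

lemma occSign_mul_self (b : Bool) : occSign b * occSign b = 1 := by cases b <;> simp [occSign]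

variable [LocallyFiniteOrderBot ι]

/-- The Jordan-Wigner sign of the site `k`, the parity of the number of particles before `k`. -/
def jwSign (k : ι) (η : ι → Bool) : ℂ := ∏ j ∈ Finset.Iio k, occSign (η j)

lemma jwSign_flipSite_of_le {j k : ι} (h : j ≤ k) (η : ι → Bool) :
    jwSign j (flipSite k η) = jwSign j η :=
  Finset.prod_congr rfl fun i hi => by
    rw [flipSite_of_ne ((Finset.mem_Iio.1 hi).trans_le h).ne]

lemma jwSign_flipSite_of_lt {j k : ι} (h : k < j) (η : ι → Bool) :
    jwSign j (flipSite k η) = -jwSign j η := by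
  have hk : k ∈ Finset.Iio j := Finset.mem_Iio.2 h
  rw [jwSign, jwSign, ← Finset.mul_prod_erase _ _ hk, ← Finset.mul_prod_erase _ _ hk,
    flipSite_same, occSign_not, neg_mul]
  congr 2
  exact Finset.prod_congr rfl fun i hi => by rw [flipSite_of_ne (Finset.ne_of_mem_erase hi)]

lemma jwSign_mul_self (k : ι) (η : ι → Bool) : jwSign k η * jwSign k η = 1 := by
  rw [jwSign, ← Finset.prod_mul_distrib]
  exact Finset.prod_eq_one fun i _ => occSign_mul_self _

lemma jwSign_of_isMin {k : ι} (hk : IsMin k) (η : ι → Bool) : jwSign k η = 1 := by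
  rw [jwSign, Finset.Iio_eq_empty.2 hk, Finset.prod_empty]

lemma jwSign_of_covBy {j k : ι} (h : j ⋖ k) (η : ι → Bool) :
    jwSign k η = occSign (η j) * jwSign j η := by
  have hIio : Finset.Iio k = insert j (Finset.Iio j) := by
    ext i
    simp only [Finset.mem_Iio, Finset.mem_insert, ← le_iff_eq_or_lt, h.lt_iff_le_left]
  rw [jwSign, hIio, Finset.prod_insert (by simp), jwSign]

lemma occSign_mul_jwSign_of_isMax [Fintype ι] {k : ι} (hk : IsMax k) (η : ι → Bool) :
    occSign (η k) * jwSign k η = ∏ j, occSign (η j) := by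
  have huniv : (Finset.univ : Finset ι) = insert k (Finset.Iio k) := by
    ext i
    simp only [Finset.mem_univ, Finset.mem_insert, Finset.mem_Iio, ← le_iff_eq_or_lt, hk.isTop i]
  rw [huniv, Finset.prod_insert (by simp), jwSign]

/-- The Jordan-Wigner transform of the one-site operator which flips the occupation `b` of the site
`k` with amplitude `u b`. -/
def siteOp (u : Bool → ℂ) (k : ι) : ((ι → Bool) → ℂ) →L[ℂ] ((ι → Bool) → ℂ) :=
  ContinuousLinearMap.pi fun η =>
    (jwSign k η * u (η k)) • ContinuousLinearMap.proj (flipSite k η)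

@[simp] lemma siteOp_apply (u : Bool → ℂ) (k : ι) (f : (ι → Bool) → ℂ) (η : ι → Bool) :
    siteOp u k f η = jwSign k η * u (η k) * f (flipSite k η) := rfl

lemma siteOp_mul_of_lt (u v : Bool → ℂ) {j k : ι} (h : j < k) :
    siteOp u j * siteOp v k = -(siteOp v k * siteOp u j) := by
  ext f η
  simp only [mul_apply_eq_comp, siteOp_apply, neg_apply, Pi.neg_apply]
  rw [jwSign_flipSite_of_lt h, jwSign_flipSite_of_le h.le, flipSite_of_ne h.ne',
    flipSite_of_ne h.ne, flipSite_comm]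
  ring

lemma siteOp_mul_of_ne (u v : Bool → ℂ) {j k : ι} (h : j ≠ k) :
    siteOp u j * siteOp v k = -(siteOp v k * siteOp u j) := by
  rcases lt_or_gt_of_ne h with h | h
  · exact siteOp_mul_of_lt u v h
  · rw [siteOp_mul_of_lt v u h, neg_neg]

lemma siteOp_mul_self_apply (u v : Bool → ℂ) (k : ι) (f : (ι → Bool) → ℂ) (η : ι → Bool) :
    (siteOp u k * siteOp v k) f η = u (η k) * v (!(η k)) * f η := by
  simp only [mul_apply_eq_comp, siteOp_apply, flipSite_same, flipSite_flipSite]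
  rw [jwSign_flipSite_of_le le_rfl]
  linear_combination (u (η k) * v (!(η k)) * f η) * jwSign_mul_self k η

/-- The fermionic annihilation operator. Operators act on functions of the configuration, so that
its amplitude is the indicator of the empty site. -/
def annih (k : ι) : ((ι → Bool) → ℂ) →L[ℂ] ((ι → Bool) → ℂ) :=
  siteOp (fun b => if b then 0 else 1) k

/-- The fermionic creation operator. -/
def creat (k : ι) : ((ι → Bool) → ℂ) →L[ℂ] ((ι → Bool) → ℂ) :=
  siteOp (fun b => if b then 1 else 0) k

lemma isCAR_annih_creat : IsCAR (annih (ι := ι)) creat where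
  creat_mul_creat j k := by
    rcases eq_or_ne j k with rfl | h
    · ext f η
      simp only [creat, neg_apply, Pi.neg_apply, siteOp_mul_self_apply]
      cases η j <;> simp
    · exact siteOp_mul_of_ne _ _ h
  annih_mul_creat j k := by
    rcases eq_or_ne j k with rfl | h
    · ext f η
      simp only [annih, creat, if_true, sub_apply, Pi.sub_apply, siteOp_mul_self_apply,
        one_apply_eq_self]
      cases η j <;> simp
    · rw [if_neg h, zero_sub]
      exact siteOp_mul_of_ne _ _ h

lemma creat_apply_empty (k : ι) (f : (ι → Bool) → ℂ) : creat k f (fun _ => false) = 0 := by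
  simp [creat]

/-- The fermionic vacuum, the indicator function of the empty configuration. -/
def vacuum (η : ι → Bool) : ℂ := open Classical in if η = fun _ => false then 1 else 0

lemma annih_vacuum (k : ι) : annih k vacuum = 0 := by
  funext η
  by_cases h : η k = true
  · simp [annih, h]
  · have hflip : flipSite k η ≠ fun _ => false := fun hη => by
      simpa [h] using congrFun hη k
    rw [annih, siteOp_apply, vacuum, if_neg hflip, mul_zero, Pi.zero_apply]

end JordanWigner

section Lattice

variable {L : ℕ}

lemma next_eq_finRotate (k : Fin L) : next k = finRotate L k := by
  obtain _ | n := L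
  · exact k.elim0
  · ext
    simp [next, finRotate_apply, Fin.val_add]

lemma sum_next {M : Type*} [AddCommMonoid M] (f : Fin L → M) : ∑ k, f (next k) = ∑ k, f k := by
  simpa only [next_eq_finRotate] using Equiv.sum_comp (finRotate L) f

lemma next_ne (hL : 2 ≤ L) (k : Fin L) : next k ≠ k := by
  rw [next_eq_finRotate, ← Equiv.Perm.mem_support, support_finRotate_of_le hL]
  exact Finset.mem_univ k

lemma val_next_of_lt {k : Fin L} (hk : k.val + 1 < L) : (next k).val = k.val + 1 :=
  Nat.mod_eq_of_lt hk

lemma covBy_next {k : Fin L} (hk : k.val + 1 < L) : k ⋖ next k := by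
  refine ⟨?_, fun j hkj hj => ?_⟩
  · rw [Fin.lt_def, val_next_of_lt hk]
    exact Nat.lt_succ_self _
  · rw [Fin.lt_def, val_next_of_lt hk] at hj
    exact absurd hkj (not_lt.2 (Nat.le_of_lt_succ hj))

lemma isMax_of_not_lt {k : Fin L} (hk : ¬k.val + 1 < L) : IsMax k := fun j _ => by
  rw [Fin.le_def]
  omega

lemma isMin_next_of_not_lt {k : Fin L} (hk : ¬k.val + 1 < L) : IsMin (next k) := fun j _ => by
  have hlast : k.val + 1 = L := by omega
  simp [Fin.le_def, next, hlast]

lemma flipSite_flipSite_next (hL : 2 ≤ L) (k : Fin L) (η : Config L) :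
    flipSite (next k) (flipSite k η) = flipBond k η := by
  have hne := next_ne hL k
  funext j
  rcases eq_or_ne j k with rfl | hj
  · simp [flipBond, flipSite_of_ne hne.symm]
  rcases eq_or_ne j (next k) with rfl | hj'
  · simp [flipBond, flipSite_of_ne hne]
  · simp [flipBond, flipSite_of_ne hj, flipSite_of_ne hj', hj, hj']

lemma prod_occSign (η : Config L) : ∏ j, occSign (η j) = (-1) ^ numParticles η := by
  simp only [occSign, numParticles, Finset.prod_ite, Finset.prod_const, one_pow, mul_one]

/-- The sign of the bond `(k, k + 1)` under antiperiodic boundary conditions, which the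
Jordan-Wigner transform produces in the sector of even particle number. -/
def bondSign (k : Fin L) : ℂ := if k.val + 1 < L then 1 else -1

lemma bondSign_mul_jwSign_mul_jwSign (k : Fin L) {η : Config L}
    (hη : Even (numParticles η)) :
    bondSign k * (jwSign k η * jwSign (next k) (flipSite k η)) = -occSign (η k) := by
  by_cases hk : k.val + 1 < L
  · rw [jwSign_flipSite_of_lt (covBy_next hk).lt, jwSign_of_covBy (covBy_next hk), bondSign,
      if_pos hk]
    linear_combination -occSign (η k) * jwSign_mul_self k η
  · have hparity : occSign (η k) * jwSign k η = 1 := by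
      rw [occSign_mul_jwSign_of_isMax (isMax_of_not_lt hk), prod_occSign, hη.neg_one_pow]
    rw [jwSign_of_isMin (isMin_next_of_not_lt hk), bondSign, if_neg hk]
    linear_combination -occSign (η k) * hparity + jwSign k η * occSign_mul_self (η k)

lemma bondSign_mul_siteOp_mul_siteOp_next (hL : 2 ≤ L) (u v : Bool → ℂ) (k : Fin L)
    (f : Config L → ℂ) {η : Config L} (hη : Even (numParticles η)) :
    bondSign k * (siteOp u k * siteOp v (next k)) f η =
      -(occSign (η k) * u (η k) * v (η (next k)) * f (flipBond k η)) := by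
  rw [mul_apply_eq_comp, siteOp_apply, siteOp_apply, flipSite_of_ne (next_ne hL k),
    flipSite_flipSite_next hL]
  linear_combination (u (η k) * v (η (next k)) * f (flipBond k η)) *
    bondSign_mul_jwSign_mul_jwSign k hη

/-- The matrix of the antiperiodic shift by one site. -/
def shiftMatrix (L : ℕ) : Matrix (Fin L) (Fin L) ℂ :=
  fun x y => if y = next x then bondSign x else 0

lemma quadForm_shiftMatrix {A : Type*} [Ring A] [Algebra ℂ A] (a b : Fin L → A) :
    quadForm a b (shiftMatrix L) = ∑ k, bondSign k • (a k * b (next k)) := by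
  simp [quadForm_apply, shiftMatrix, ite_smul]

lemma quadForm_shiftMatrix_transpose {A : Type*} [Ring A] [Algebra ℂ A] (a b : Fin L → A) :
    quadForm a b (shiftMatrix L).transpose = ∑ k, bondSign k • (a (next k) * b k) := by
  rw [quadForm_apply, Finset.sum_comm]
  simp [shiftMatrix, ite_smul]

/-- The rate at which particles jump across the bond `(k, k + 1)`. -/
def jumpRate (w : ℝ) (k : Fin L) (η : Config L) : ℝ := w * (occ η k + occ η (next k))

/-- The generator of the configuration process tilted by the weight `z` per jump. -/
def tiltedOp (w μ z : ℝ) (L : ℕ) : (Config L → ℝ) →L[ℝ] (Config L → ℝ) :=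
  ContinuousLinearMap.pi fun η => ∑ k : Fin L,
    ((μ + z * jumpRate w k η) • ContinuousLinearMap.proj (flipBond k η)
      - (μ + jumpRate w k η) • ContinuousLinearMap.proj η)

lemma tiltedOp_apply (w μ z : ℝ) (f : Config L → ℝ) (η : Config L) :
    tiltedOp w μ z L f η = ∑ k : Fin L,
      ((μ + z * jumpRate w k η) * f (flipBond k η) - (μ + jumpRate w k η) * f η) := by
  simp [tiltedOp, sum_apply]

/-- The quadratic fermionic Hamiltonian, with antiperiodic boundary conditions, which represents
the tilted generator up to the constant `-L * μ` in the sector of even particle number. -/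
def hamiltonian (w μ z : ℂ) (L : ℕ) : (Config L → ℂ) →L[ℂ] (Config L → ℂ) :=
  quadForm creat annih
      ((-2 * w) • 1 + (μ + w * z) • (shiftMatrix L + (shiftMatrix L).transpose))
    + quadForm creat creat ((μ + 2 * w * z) • shiftMatrix L)
    + quadForm annih annih (-μ • shiftMatrix L)

lemma hamiltonian_eq_sum (hL : 2 ≤ L) (w μ z : ℂ) :
    hamiltonian w μ z L = ∑ k : Fin L, ((-2 * w) • (creat k * annih k)
      + (μ + w * z) • (bondSign k • (creat k * annih (next k))
        - bondSign k • (annih k * creat (next k)))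
      + (μ + 2 * w * z) • bondSign k • (creat k * creat (next k))
      - μ • bondSign k • (annih k * annih (next k))) := by
  have hone : quadForm creat annih (1 : Matrix (Fin L) (Fin L) ℂ) =
      ∑ k : Fin L, creat k * annih k := by
    simp [quadForm_apply, Matrix.one_apply, ite_smul]
  have hswap (k : Fin L) : creat (next k) * annih k = -(annih k * creat (next k)) := by
    rw [isCAR_annih_creat.annih_mul_creat, if_neg (next_ne hL k).symm, zero_sub, neg_neg]
  simp only [hamiltonian, map_add, map_smul, hone, quadForm_shiftMatrix,
    quadForm_shiftMatrix_transpose, hswap, Finset.sum_add_distrib, Finset.sum_sub_distrib,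
    Finset.smul_sum, smul_add, smul_sub, smul_neg, neg_smul, map_neg, Finset.sum_neg_distrib]
  abel

lemma hamiltonian_apply_of_even (hL : 2 ≤ L) (w μ z : ℝ) (f : Config L → ℂ) {η : Config L}
    (hη : Even (numParticles η)) :
    hamiltonian w μ z L f η = ∑ k : Fin L, (((μ + z * jumpRate w k η : ℝ) : ℂ) * f (flipBond k η)
      - (jumpRate w k η : ℂ) * f η) := by
  have hdiagonal : ∑ k : Fin L, (jumpRate w k η : ℂ) * f η =
      ∑ k : Fin L, ((2 * w * occ η k : ℝ) : ℂ) * f η := by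
    rw [← Finset.sum_mul, ← Finset.sum_mul, ← Complex.ofReal_sum, ← Complex.ofReal_sum]
    simp only [jumpRate, ← Finset.mul_sum, Finset.sum_add_distrib, sum_next (occ η), mul_assoc,
      ← two_mul, mul_left_comm w]
  have hbond (u v : Bool → ℂ) (k : Fin L) :=
    bondSign_mul_siteOp_mul_siteOp_next hL u v k f hη
  rw [Finset.sum_sub_distrib, hdiagonal, ← Finset.sum_sub_distrib, hamiltonian_eq_sum hL,
    sum_apply, Finset.sum_apply]
  refine Finset.sum_congr rfl fun k _ => ?_
  simp only [creat, annih, add_apply, sub_apply, smul_apply, Pi.add_apply, Pi.sub_apply,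
    Pi.smul_apply, smul_eq_mul, hbond, siteOp_mul_self_apply, jumpRate, occ, occSign]
  cases η k <;> cases η (next k) <;>
    simp only [reduceIte, Bool.not_true, Bool.not_false, Bool.false_eq_true] <;>
    push_cast <;> ring

lemma tiltedOp_re_of_even (hL : 2 ≤ L) (w μ z : ℝ) (f : Config L → ℂ) {η : Config L}
    (hη : Even (numParticles η)) :
    tiltedOp w μ z L (fun ξ => (f ξ).re) η =
      (hamiltonian w μ z L f η).re - L * μ * (f η).re := by
  rw [hamiltonian_apply_of_even hL w μ z f hη, tiltedOp_apply, Complex.re_sum]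
  simp only [Complex.sub_re, Complex.re_ofReal_mul, add_mul, Finset.sum_sub_distrib,
    Finset.sum_add_distrib, Finset.sum_const, Finset.card_univ, Fintype.card_fin, nsmul_eq_mul]
  ring

end Lattice

section AntiperiodicFourier

variable {L : ℕ}

/-- The momenta `q = (2 j + 1) π / L` of antiperiodic plane waves on `L` sites. -/
def momentum (L j : ℕ) : ℝ := (2 * j + 1) * Real.pi / L

lemma natCast_pos_of_fin (j : Fin L) : (0 : ℝ) < L := Nat.cast_pos.2 j.pos

lemma momentum_pos (j : Fin L) : 0 < momentum L j := by
  have hL := natCast_pos_of_fin j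
  unfold momentum
  positivity

lemma momentum_rev (j : Fin L) : momentum L (Fin.rev j) = 2 * Real.pi - momentum L j := by
  have hL := natCast_pos_of_fin j
  have hrev : ((Fin.rev j : ℕ) : ℝ) = L - (j + 1) := by
    rw [Fin.val_rev, Nat.cast_sub j.isLt, Nat.cast_succ]
  rw [momentum, momentum, hrev]
  field_simp
  ring

lemma momentum_lt_two_pi (j : Fin L) : momentum L j < 2 * Real.pi := by
  have hrev := momentum_rev (Fin.rev j)
  rw [Fin.rev_rev] at hrev
  linarith [momentum_pos (Fin.rev j)]

lemma cos_momentum_ne_one (j : Fin L) : Real.cos (momentum L j) ≠ 1 := fun h => by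
  have hpos := momentum_pos j
  have hlt := momentum_lt_two_pi j
  rw [Real.cos_eq_one_iff_of_lt_of_lt (by linarith) hlt] at h
  exact hpos.ne' h

lemma cos_momentum_rev (j : Fin L) :
    Real.cos (momentum L (Fin.rev j)) = Real.cos (momentum L j) := by
  rw [momentum_rev, Real.cos_two_pi_sub]

lemma sin_momentum_rev (j : Fin L) :
    Real.sin (momentum L (Fin.rev j)) = -Real.sin (momentum L j) := by
  rw [momentum_rev, Real.sin_two_pi_sub]

lemma sum_eq_zero_of_rev_eq_neg {f : Fin L → ℝ} (hf : ∀ j, f (Fin.rev j) = -f j) :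
    ∑ j, f j = 0 := by
  have hsum : ∑ j, f j = -∑ j, f j := by
    conv_lhs => rw [← Equiv.sum_comp Fin.revPerm]
    simp only [Fin.revPerm_apply, hf, Finset.sum_neg_distrib]
  linarith

/-- The phase `exp (i q)` of the plane wave with momentum `q`. -/
def phase (L : ℕ) (j : Fin L) : ℂ := Complex.exp (momentum L j * Complex.I)

lemma phase_eq (j : Fin L) :
    phase L j = Real.cos (momentum L j) + Real.sin (momentum L j) * Complex.I := by
  rw [phase, Complex.exp_mul_I, Complex.ofReal_cos, Complex.ofReal_sin]

lemma phase_ne_zero (j : Fin L) : phase L j ≠ 0 := Complex.exp_ne_zero _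

lemma phase_inv (j : Fin L) :
    (phase L j)⁻¹ = Real.cos (momentum L j) - Real.sin (momentum L j) * Complex.I := by
  rw [phase, ← Complex.exp_neg, ← neg_mul, Complex.exp_mul_I, Complex.cos_neg, Complex.sin_neg,
    Complex.ofReal_cos, Complex.ofReal_sin, neg_mul, sub_eq_add_neg]

lemma phase_rev (j : Fin L) : phase L (Fin.rev j) = (phase L j)⁻¹ := by
  rw [phase_eq, phase_inv, cos_momentum_rev, sin_momentum_rev, Complex.ofReal_neg, neg_mul,
    sub_eq_add_neg]

lemma phase_eq_pow (j : Fin L) :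
    phase L j = Complex.exp (2 * Real.pi * Complex.I / (2 * L : ℕ)) ^ (2 * j.val + 1) := by
  have hL : (L : ℂ) ≠ 0 := Nat.cast_ne_zero.2 j.pos.ne'
  rw [phase, momentum, ← Complex.exp_nat_mul]
  congr 1
  push_cast
  field_simp

lemma phase_pow_card (j : Fin L) : phase L j ^ L = -1 := by
  have hL : (L : ℂ) ≠ 0 := Nat.cast_ne_zero.2 j.pos.ne'
  have hroot : Complex.exp (2 * Real.pi * Complex.I / (2 * L : ℕ)) ^ L = -1 := by
    rw [← Complex.exp_nat_mul, ← Complex.exp_pi_mul_I]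
    congr 1
    push_cast
    field_simp
  rw [phase_eq_pow, pow_right_comm, hroot, Odd.neg_one_pow ⟨j, rfl⟩]

lemma phase_injective : Function.Injective (phase L) := fun j k h => by
  have hroot := Complex.isPrimitiveRoot_exp (2 * L) (by have := j.pos; omega)
  rw [phase_eq_pow, phase_eq_pow] at h
  have hexponent := hroot.pow_inj (by omega) (by omega) h
  omega

/-- The matrix whose columns are the antiperiodic plane waves. -/
def waveMatrix (L : ℕ) : Matrix (Fin L) (Fin L) ℂ := fun x j => phase L j ^ (x : ℕ)

/-- The inverse of the matrix of plane waves. -/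
def waveInv (L : ℕ) : Matrix (Fin L) (Fin L) ℂ := fun j x => (L : ℂ)⁻¹ * ((phase L j)⁻¹) ^ (x : ℕ)

lemma waveInv_mul_waveMatrix (L : ℕ) : waveInv L * waveMatrix L = 1 := by
  ext j k
  have hL : (L : ℂ) ≠ 0 := Nat.cast_ne_zero.2 j.pos.ne'
  have hgeom : (waveInv L * waveMatrix L) j k =
      (L : ℂ)⁻¹ * ∑ x ∈ Finset.range L, ((phase L j)⁻¹ * phase L k) ^ x := by
    simp only [Matrix.mul_apply, waveInv, waveMatrix, mul_assoc, ← mul_pow, ← Finset.mul_sum]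
    rw [Fin.sum_univ_eq_sum_range (fun x => ((phase L j)⁻¹ * phase L k) ^ x) L]
  rw [hgeom]
  rcases eq_or_ne j k with rfl | h
  · simp [inv_mul_cancel₀ (phase_ne_zero j), hL]
  · have hne : (phase L j)⁻¹ * phase L k ≠ 1 := fun hone =>
      h (phase_injective ((inv_mul_eq_one₀ (phase_ne_zero j)).1 hone))
    rw [geom_sum_eq hne, mul_pow, inv_pow, phase_pow_card, phase_pow_card, Matrix.one_apply_ne h]
    norm_num

lemma waveMatrix_mul_waveInv (L : ℕ) : waveMatrix L * waveInv L = 1 :=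
  mul_eq_one_comm.1 (waveInv_mul_waveMatrix L)

/-- The matrix which is diagonal in the basis of antiperiodic plane waves with eigenvalues `m`, as
an algebra homomorphism in `m`. -/
def symbolMatrix (L : ℕ) : (Fin L → ℂ) →ₐ[ℂ] Matrix (Fin L) (Fin L) ℂ :=
  AlgHom.ofLinearMap
    { toFun m := waveMatrix L * Matrix.diagonal m * waveInv L
      map_add' m n := by
        rw [← Matrix.add_mul, ← Matrix.mul_add, Matrix.diagonal_add]
        rfl
      map_smul' a m := by
        rw [Matrix.diagonal_smul, Matrix.mul_smul, Matrix.smul_mul, RingHom.id_apply] }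
    (by
      change waveMatrix L * Matrix.diagonal (fun _ => 1) * waveInv L = 1
      rw [Matrix.diagonal_one, Matrix.mul_one, waveMatrix_mul_waveInv])
    (fun m n => by
      change waveMatrix L * Matrix.diagonal (fun j => m j * n j) * waveInv L =
        waveMatrix L * Matrix.diagonal m * waveInv L *
          (waveMatrix L * Matrix.diagonal n * waveInv L)
      rw [← Matrix.diagonal_mul_diagonal]
      simp only [Matrix.mul_assoc]
      rw [← Matrix.mul_assoc (waveInv L) (waveMatrix L), waveInv_mul_waveMatrix, Matrix.one_mul])

lemma symbolMatrix_eq_mul (m : Fin L → ℂ) :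
    symbolMatrix L m = waveMatrix L * Matrix.diagonal m * waveInv L := rfl

lemma symbolMatrix_apply (m : Fin L → ℂ) (x y : Fin L) :
    symbolMatrix L m x y =
      ∑ j, phase L j ^ (x : ℕ) * m j * ((L : ℂ)⁻¹ * ((phase L j)⁻¹) ^ (y : ℕ)) := by
  simp only [symbolMatrix_eq_mul, Matrix.mul_apply (M := waveMatrix L * Matrix.diagonal m),
    Matrix.mul_diagonal, waveMatrix, waveInv]

lemma symbolMatrix_transpose (m : Fin L → ℂ) :
    (symbolMatrix L m).transpose = symbolMatrix L (m ∘ Fin.rev) := by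
  ext x y
  rw [Matrix.transpose_apply, symbolMatrix_apply, symbolMatrix_apply, ← Equiv.sum_comp Fin.revPerm]
  refine Finset.sum_congr rfl fun j _ => ?_
  rw [Fin.revPerm_apply, phase_rev, inv_inv, Function.comp_apply]
  ring

lemma trace_symbolMatrix (m : Fin L → ℂ) : (symbolMatrix L m).trace = ∑ j, m j := by
  rw [symbolMatrix_eq_mul, Matrix.trace_mul_comm, ← Matrix.mul_assoc, waveInv_mul_waveMatrix,
    Matrix.one_mul, Matrix.trace_diagonal]

lemma shiftMatrix_eq_symbolMatrix (L : ℕ) : shiftMatrix L = symbolMatrix L (phase L) := by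
  have hwave : shiftMatrix L * waveMatrix L = waveMatrix L * Matrix.diagonal (phase L) := by
    ext x j
    have hshift : (shiftMatrix L * waveMatrix L) x j = bondSign x * waveMatrix L (next x) j := by
      simp [Matrix.mul_apply, shiftMatrix]
    rw [hshift, Matrix.mul_diagonal, waveMatrix, waveMatrix, ← pow_succ, bondSign]
    split_ifs with hx
    · rw [val_next_of_lt hx, one_mul]
    · have hlast : (x : ℕ) + 1 = L := by omega
      have hnext : (next x : ℕ) = 0 := by simp [next, hlast]
      rw [hnext, hlast, phase_pow_card, pow_zero, mul_one]
  rw [symbolMatrix_eq_mul, ← hwave, Matrix.mul_assoc, waveMatrix_mul_waveInv, Matrix.mul_one]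

lemma sum_cos_momentum (hL : 2 ≤ L) : ∑ j : Fin L, Real.cos (momentum L j) = 0 := by
  have htrace : (shiftMatrix L).trace = 0 :=
    Finset.sum_eq_zero fun k _ => by simp [shiftMatrix, (next_ne hL k).symm]
  rw [shiftMatrix_eq_symbolMatrix, trace_symbolMatrix] at htrace
  simpa [phase_eq, ← Complex.ofReal_cos, ← Complex.ofReal_sin] using congrArg Complex.re htrace

end AntiperiodicFourier

section LeadingEigenvector

/-- The symbol of the part of the fermionic Hamiltonian which conserves the particle number. -/
def bandEnergy (w μ z q : ℝ) : ℝ := 2 * (μ + w * z) * Real.cos q - 2 * w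

/-- The square of the energy of a fermionic excitation with momentum `q`. -/
def energySq (w μ z q : ℝ) : ℝ :=
  bandEnergy w μ z q ^ 2 + 4 * μ * (μ + 2 * w * z) * Real.sin q ^ 2

/-- The pairing amplitude of the fermions with momenta `q` and `-q` in the leading eigenvector. -/
def pairing (w μ z q : ℝ) : ℝ :=
  (bandEnergy w μ z q + √(energySq w μ z q)) / (2 * μ * Real.sin q)

variable {w μ z : ℝ} {L : ℕ}

lemma energySq_nonneg (hw : 0 ≤ w) (hμ : 0 ≤ μ) (hz : 0 ≤ z) (q : ℝ) : 0 ≤ energySq w μ z q := by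
  unfold energySq
  positivity

lemma pairing_riccati (hw : 0 ≤ w) (hμ : 0 < μ) (hz : 0 ≤ z) (q : ℝ) :
    μ * Real.sin q * pairing w μ z q ^ 2 - bandEnergy w μ z q * pairing w μ z q
      - (μ + 2 * w * z) * Real.sin q = 0 := by
  rcases eq_or_ne (Real.sin q) 0 with hs | hs
  · simp [pairing, hs]
  have hpairing : pairing w μ z q * (2 * μ * Real.sin q) =
      bandEnergy w μ z q + √(energySq w μ z q) :=
    div_mul_cancel₀ _ (by positivity)
  have hsq : √(energySq w μ z q) ^ 2 =
      bandEnergy w μ z q ^ 2 + 4 * μ * (μ + 2 * w * z) * Real.sin q ^ 2 :=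
    Real.sq_sqrt (energySq_nonneg hw hμ.le hz q)
  refine (mul_eq_zero.1 ?_).resolve_left (show 4 * μ * Real.sin q ≠ 0 by positivity)
  linear_combination (pairing w μ z q * (2 * μ * Real.sin q) - bandEnergy w μ z q
    + √(energySq w μ z q)) * hpairing + hsq

lemma two_mul_sin_mul_pairing (hw : 0 ≤ w) (hμ : 0 < μ) (hz : 0 ≤ z) {q : ℝ}
    (hq : Real.cos q ≠ 1) :
    2 * (μ * Real.sin q * pairing w μ z q) = bandEnergy w μ z q + √(energySq w μ z q) := by
  rcases eq_or_ne (Real.sin q) 0 with hs | hs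
  · have hcos : Real.cos q = -1 := (Real.sin_eq_zero_iff_cos_eq.1 hs).resolve_left hq
    have hsq : energySq w μ z q = (2 * (μ + w * z) + 2 * w) ^ 2 := by
      rw [energySq, bandEnergy, hs, hcos]
      ring
    rw [hsq, Real.sqrt_sq (by positivity), hs, bandEnergy, hcos]
    ring
  · rw [pairing]
    field_simp

lemma energySq_momentum_rev (j : Fin L) :
    energySq w μ z (momentum L (Fin.rev j)) = energySq w μ z (momentum L j) := by
  rw [energySq, energySq, bandEnergy, bandEnergy, cos_momentum_rev, sin_momentum_rev, neg_sq]

lemma pairing_momentum_rev (j : Fin L) :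
    pairing w μ z (momentum L (Fin.rev j)) = -pairing w μ z (momentum L j) := by
  rw [pairing, pairing, energySq_momentum_rev, bandEnergy, bandEnergy, cos_momentum_rev,
    sin_momentum_rev, mul_neg, div_neg]

/-- The largest eigenvalue of the tilted generator in the sector of even particle number. -/
def topEigenvalue (w μ z : ℝ) (L : ℕ) : ℝ :=
  -(L * (μ + w)) + 1 / 2 * ∑ j : Fin L, √(energySq w μ z (momentum L j))

lemma topEigenvalue_eq_sum_sin_mul_pairing (hw : 0 ≤ w) (hμ : 0 < μ) (hz : 0 ≤ z) (hL : 2 ≤ L) :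
    topEigenvalue w μ z L = -(L * μ)
      + ∑ j : Fin L, μ * Real.sin (momentum L j) * pairing w μ z (momentum L j) := by
  have hsum : 2 * ∑ j : Fin L, μ * Real.sin (momentum L j) * pairing w μ z (momentum L j) =
      -(2 * L * w) + ∑ j : Fin L, √(energySq w μ z (momentum L j)) := by
    rw [Finset.mul_sum, Finset.sum_congr rfl fun j _ =>
      two_mul_sin_mul_pairing hw hμ hz (cos_momentum_ne_one j)]
    simp only [bandEnergy, Finset.sum_add_distrib, Finset.sum_sub_distrib, ← Finset.mul_sum,
      sum_cos_momentum hL, Finset.sum_const, Finset.card_univ, Fintype.card_fin, nsmul_eq_mul]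
    ring
  rw [topEigenvalue]
  linear_combination -(1 / 2) * hsum

/-- The pairing matrix of the leading eigenvector. -/
def pairMatrix (w μ z : ℝ) (L : ℕ) : Matrix (Fin L) (Fin L) ℂ :=
  symbolMatrix L fun j => Complex.I * pairing w μ z (momentum L j)

lemma pairMatrix_transpose (w μ z : ℝ) (L : ℕ) :
    (pairMatrix w μ z L).transpose = -pairMatrix w μ z L := by
  rw [pairMatrix, symbolMatrix_transpose, ← map_neg]
  congr 1
  funext j
  simp only [Function.comp_apply, Pi.neg_apply, pairing_momentum_rev, Complex.ofReal_neg, mul_neg]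

lemma pairMatrix_riccati (hw : 0 ≤ w) (hμ : 0 < μ) (hz : 0 ≤ z) (L : ℕ) :
    (((-2 * w : ℂ) • (1 : Matrix (Fin L) (Fin L) ℂ)
        + (μ + w * z : ℂ) • (shiftMatrix L + (shiftMatrix L).transpose)) * pairMatrix w μ z L
      + (μ + 2 * w * z : ℂ) • shiftMatrix L
      + pairMatrix w μ z L * (-(μ : ℂ) • shiftMatrix L).transpose * pairMatrix w μ z L).IsSymm := by
  rw [Matrix.transpose_smul, shiftMatrix_eq_symbolMatrix, symbolMatrix_transpose, pairMatrix,
    ← map_one (symbolMatrix L)]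
  simp only [← map_add, ← map_mul, ← map_smul]
  rw [Matrix.IsSymm, symbolMatrix_transpose]
  congr 1
  funext j
  have hriccati : (μ * Real.sin (momentum L j) * pairing w μ z (momentum L j) ^ 2
      - (2 * (μ + w * z) * Real.cos (momentum L j) - 2 * w) * pairing w μ z (momentum L j)
      - (μ + 2 * w * z) * Real.sin (momentum L j) : ℂ) = 0 := by
    exact_mod_cast pairing_riccati hw hμ hz (momentum L j)
  simp only [Function.comp_apply, Pi.add_apply, Pi.mul_apply, Pi.smul_apply, Pi.one_apply,
    smul_eq_mul, Fin.rev_rev, phase_rev, pairing_momentum_rev, Complex.ofReal_neg]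
  rw [phase_inv, phase_eq]
  linear_combination (2 * Complex.I) * hriccati - (2 * μ * Real.sin (momentum L j) *
    pairing w μ z (momentum L j) ^ 2 * Complex.I) * Complex.I_sq

lemma trace_shiftMatrix_mul_pairMatrix (hw : 0 ≤ w) (hμ : 0 < μ) (hz : 0 ≤ z) (hL : 2 ≤ L) :
    (-(μ : ℂ) • shiftMatrix L * pairMatrix w μ z L).trace =
      ((topEigenvalue w μ z L + L * μ : ℝ) : ℂ) := by
  have hodd : ∑ j : Fin L, Real.cos (momentum L j) * pairing w μ z (momentum L j) = 0 :=
    sum_eq_zero_of_rev_eq_neg fun j => by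
      rw [cos_momentum_rev, pairing_momentum_rev, mul_neg]
  have hterm (j : Fin L) : -(μ : ℂ) * (phase L j * (Complex.I * pairing w μ z (momentum L j))) =
      -μ * Complex.I * ((Real.cos (momentum L j) * pairing w μ z (momentum L j) : ℝ) : ℂ)
        + ((μ * Real.sin (momentum L j) * pairing w μ z (momentum L j) : ℝ) : ℂ) := by
    simp only [phase_eq, Complex.ofReal_mul]
    linear_combination
      -(μ * Real.sin (momentum L j) * pairing w μ z (momentum L j) : ℂ) * Complex.I_sq
  rw [topEigenvalue_eq_sum_sin_mul_pairing hw hμ hz hL, shiftMatrix_eq_symbolMatrix, pairMatrix,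
    ← map_smul, ← map_mul, trace_symbolMatrix]
  simp only [Pi.mul_apply, Pi.smul_apply, smul_eq_mul, mul_assoc (-(μ : ℂ)) (phase L _)]
  rw [Finset.sum_congr rfl fun j _ => hterm j, Finset.sum_add_distrib, ← Finset.mul_sum,
    ← Complex.ofReal_sum, ← Complex.ofReal_sum, hodd]
  push_cast
  ring

/-- The leading eigenvector of the fermionic Hamiltonian, a Gaussian state. -/
def leadingState (w μ z : ℝ) (L : ℕ) : Config L → ℂ :=
  gaussOp creat (pairMatrix w μ z L) vacuum

theorem hamiltonian_leadingState (hw : 0 ≤ w) (hμ : 0 < μ) (hz : 0 ≤ z) (hL : 2 ≤ L) :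
    hamiltonian w μ z L (leadingState w μ z L) =
      ((topEigenvalue w μ z L + L * μ : ℝ) : ℂ) • leadingState w μ z L := by
  have _ : IsScalarTower ℂ ((Config L → ℂ) →L[ℂ] (Config L → ℂ)) (Config L → ℂ) :=
    ⟨fun _ _ _ => rfl⟩
  rw [← trace_shiftMatrix_mul_pairMatrix hw hμ hz hL]
  exact isCAR_annih_creat.quadForm_smul_gaussOp_smul annih_vacuum (pairMatrix_transpose w μ z L)
    (pairMatrix_riccati hw hμ hz L)

lemma leadingState_empty (w μ z : ℝ) (L : ℕ) : leadingState w μ z L (fun _ => false) = 1 := by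
  let restrict : (Config L → ℂ) →L[ℂ] (Config L → ℂ) :=
    (ContinuousLinearMap.proj fun _ => false).smulRight vacuum
  have hcreat (k : Fin L) : restrict * creat k = 0 := by
    ext f η
    simp only [restrict, mul_apply_eq_comp, ContinuousLinearMap.smulRight_apply,
      ContinuousLinearMap.proj_apply, creat_apply_empty, zero_smul, zero_apply]
  have happly := congrArg (fun T : (Config L → ℂ) →L[ℂ] (Config L → ℂ) => T vacuum fun _ => false)
    (mul_gaussOp_of_mul_eq_zero hcreat (pairMatrix w μ z L))
  simpa [restrict, vacuum, leadingState] using happly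

/-- The leading eigenvector of the tilted generator, normalised at the empty configuration. Only
its values at configurations with an even number of particles are meaningful. -/
def leadingVector (w μ z : ℝ) (L : ℕ) (η : Config L) : ℝ := (leadingState w μ z L η).re

lemma leadingVector_empty (w μ z : ℝ) (L : ℕ) : leadingVector w μ z L (fun _ => false) = 1 := by
  rw [leadingVector, leadingState_empty, Complex.one_re]

theorem tiltedOp_leadingVector (hw : 0 ≤ w) (hμ : 0 < μ) (hz : 0 ≤ z) (hL : 2 ≤ L)
    {η : Config L} (hη : Even (numParticles η)) :
    tiltedOp w μ z L (leadingVector w μ z L) η =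
      topEigenvalue w μ z L * leadingVector w μ z L η := by
  refine (tiltedOp_re_of_even hL w μ z _ hη).trans ?_
  rw [hamiltonian_leadingState hw hμ hz hL, Pi.smul_apply, smul_eq_mul, Complex.re_ofReal_mul,
    leadingVector]
  ring

lemma continuous_leadingVector (w μ : ℝ) (L : ℕ) (η : Config L) :
    Continuous fun z => leadingVector w μ z L η := by
  have hpairing (j : Fin L) : Continuous fun z => pairing w μ z (momentum L j) := by
    unfold pairing energySq bandEnergy
    fun_prop
  have hmatrix : Continuous fun z => pairMatrix w μ z L := by
    refine continuous_matrix fun x y => ?_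
    simp only [pairMatrix, symbolMatrix_apply]
    fun_prop
  have hstate : Continuous fun z => leadingState w μ z L :=
    ((continuous_gaussOp (creat (ι := Fin L))).comp hmatrix).clm_apply continuous_const
  exact Complex.continuous_re.comp ((continuous_apply η).comp hstate)

end LeadingEigenvector

section EvenSector

variable {L : ℕ}

lemma even_numParticles_iff (η : Config L) :
    Even (numParticles η) ↔ ∏ j, occSign (η j) = 1 := by
  rw [prod_occSign, neg_one_pow_eq_one_iff_even (by norm_num)]

lemma even_numParticles_empty (L : ℕ) : Even (numParticles (fun _ : Fin L => false)) := by
  simp [numParticles]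

lemma prod_occSign_flipSite (k : Fin L) (η : Config L) :
    ∏ j, occSign (flipSite k η j) = -∏ j, occSign (η j) := by
  rw [← Finset.mul_prod_erase _ _ (Finset.mem_univ k), flipSite_same, occSign_not, neg_mul,
    ← Finset.mul_prod_erase _ (fun j => occSign (η j)) (Finset.mem_univ k)]
  congr 2
  exact Finset.prod_congr rfl fun i hi => by rw [flipSite_of_ne (Finset.ne_of_mem_erase hi)]

lemma even_numParticles_flipBond (hL : 2 ≤ L) (k : Fin L) {η : Config L}
    (hη : Even (numParticles η)) : Even (numParticles (flipBond k η)) := by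
  rw [even_numParticles_iff] at hη ⊢
  rw [← flipSite_flipSite_next hL, prod_occSign_flipSite, prod_occSign_flipSite, neg_neg, hη]

lemma flipBond_flipBond (k : Fin L) (η : Config L) : flipBond k (flipBond k η) = η := by
  funext j
  by_cases h : j = k ∨ j = next k <;> simp [flipBond, h]

/-- Two configurations are adjacent when they differ by the flip of a bond, which is the edge
relation of the transition graph of the chain. -/
def BondAdj (η ζ : Config L) : Prop := ∃ k, flipBond k η = ζ

instance : Std.Symm (BondAdj (L := L)) where
  symm η ζ := fun ⟨k, hk⟩ => ⟨k, by rw [← hk, flipBond_flipBond]⟩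

lemma even_numParticles_of_reflTransGen (hL : 2 ≤ L) {η ζ : Config L}
    (h : Relation.ReflTransGen BondAdj η ζ) (hη : Even (numParticles η)) :
    Even (numParticles ζ) := by
  induction h with
  | refl => exact hη
  | tail _ hadj ih =>
    obtain ⟨k, rfl⟩ := hadj
    exact even_numParticles_flipBond hL k ih

lemma exists_reflTransGen_bondAdj_clear (η : Config L) {m : ℕ} (hm : m < L) :
    ∃ ζ, Relation.ReflTransGen BondAdj η ζ ∧ ∀ j : Fin L, j.val < m → ζ j = false := by
  induction m with
  | zero => exact ⟨η, .refl, fun j hj => absurd hj (Nat.not_lt_zero _)⟩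
  | succ m ih =>
    obtain ⟨ζ, hreach, hclear⟩ := ih (by omega)
    let k : Fin L := ⟨m, by omega⟩
    have hnext : (next k).val = m + 1 := val_next_of_lt hm
    cases hk : ζ k
    · refine ⟨ζ, hreach, fun j hj => ?_⟩
      rcases Nat.lt_succ_iff_lt_or_eq.1 hj with hj | hj
      · exact hclear j hj
      · rwa [show j = k from Fin.ext hj]
    · refine ⟨flipBond k ζ, hreach.tail ⟨k, rfl⟩, fun j hj => ?_⟩
      have hj_next : j ≠ next k := fun h => by omega
      rcases Nat.lt_succ_iff_lt_or_eq.1 hj with hj | hj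
      · have hjk : j ≠ k := fun h => by simp [h, k] at hj
        simp [flipBond, hjk, hj_next, hclear j hj]
      · simp [flipBond, show j = k from Fin.ext hj, hk]

lemma eq_empty_of_even {η : Config L} (hη : Even (numParticles η))
    (hclear : ∀ j : Fin L, j.val < L - 1 → η j = false) : η = fun _ => false := by
  funext j
  by_contra hj
  have hlast (i : Fin L) (hi : i ≠ j) : η i = false := by
    refine hclear i ?_
    have hj_last : ¬j.val < L - 1 := fun h => hj (hclear j h)
    omega
  rw [even_numParticles_iff, Finset.prod_eq_single_of_mem j (Finset.mem_univ j) fun i _ hi => by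
    rw [hlast i hi, occSign, if_neg Bool.false_ne_true], eq_true_of_ne_false hj] at hη
  norm_num [occSign] at hη

lemma reflTransGen_bondAdj_empty (hL : 2 ≤ L) {η : Config L} (hη : Even (numParticles η)) :
    Relation.ReflTransGen BondAdj η fun _ => false := by
  obtain ⟨ζ, hreach, hclear⟩ := exists_reflTransGen_bondAdj_clear η (show L - 1 < L by omega)
  rwa [← eq_empty_of_even (even_numParticles_of_reflTransGen hL hreach hη) hclear]

lemma reflTransGen_bondAdj (hL : 2 ≤ L) {η ζ : Config L} (hη : Even (numParticles η))
    (hζ : Even (numParticles ζ)) : Relation.ReflTransGen BondAdj η ζ :=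
  (reflTransGen_bondAdj_empty hL hη).trans (symm (reflTransGen_bondAdj_empty hL hζ))

end EvenSector

section PerronFrobenius

variable {w μ z : ℝ} {L : ℕ}

lemma jumpRate_nonneg (hw : 0 ≤ w) (k : Fin L) (η : Config L) : 0 ≤ jumpRate w k η := by
  unfold jumpRate occ
  positivity

lemma eq_zero_of_tiltedOp_eq (hw : 0 ≤ w) (hμ : 0 < μ) (hz : 0 ≤ z) (hL : 2 ≤ L) {r : ℝ}
    {f : Config L → ℝ} (hf : ∀ η, Even (numParticles η) → 0 ≤ f η)
    (heigen : ∀ η, Even (numParticles η) → tiltedOp w μ z L f η = r * f η) {η ζ : Config L}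
    (hη : Even (numParticles η)) (hζ : Even (numParticles ζ)) (hzero : f η = 0) : f ζ = 0 := by
  induction reflTransGen_bondAdj hL hη hζ with
  | refl => exact hzero
  | tail hreach hadj ih =>
    rename_i ξ _
    obtain ⟨k, rfl⟩ := hadj
    have hξ := even_numParticles_of_reflTransGen hL hreach hη
    have hrate (j : Fin L) : 0 < μ + z * jumpRate w j ξ := by
      have := jumpRate_nonneg hw j ξ
      positivity
    have hsum := heigen ξ hξ
    simp only [tiltedOp_apply, ih hξ, mul_zero, sub_zero] at hsum
    have hterm := (Finset.sum_eq_zero_iff_of_nonneg fun j _ =>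
      mul_nonneg (hrate j).le (hf _ (even_numParticles_flipBond hL j hξ))).1 hsum k
        (Finset.mem_univ k)
    exact (mul_eq_zero.1 hterm).resolve_left (hrate k).ne'

/-- At `z = 1` the tilted generator is the generator of a Markov chain, and this is the maximum
principle for its harmonic functions. -/
lemma eq_of_tiltedOp_one_eq_zero (hw : 0 ≤ w) (hμ : 0 < μ) (hL : 2 ≤ L) {f : Config L → ℝ}
    (hf : ∀ η, Even (numParticles η) → tiltedOp w μ 1 L f η = 0) {η ζ : Config L}
    (hη : Even (numParticles η)) (hζ : Even (numParticles ζ)) : f η = f ζ := by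
  classical
  obtain ⟨ξ, hξ, hmax⟩ := (Finset.univ.filter fun η : Config L =>
    Even (numParticles η)).exists_max_image f ⟨η, by simpa using hη⟩
  simp only [Finset.mem_filter, Finset.mem_univ, true_and] at hξ hmax
  have hconst (χ : Config L) (hχ : Even (numParticles χ)) : f ξ - f χ = 0 := by
    refine eq_zero_of_tiltedOp_eq (f := fun χ => f ξ - f χ) hw hμ zero_le_one hL (r := 0)
      (fun χ hχ => sub_nonneg.2 (hmax χ hχ)) (fun χ hχ => ?_) hξ hχ (sub_self _)
    rw [zero_mul, ← neg_zero, ← hf χ hχ, tiltedOp_apply, tiltedOp_apply, ← Finset.sum_neg_distrib]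
    exact Finset.sum_congr rfl fun k _ => by ring
  linarith [hconst η hη, hconst ζ hζ]

lemma topEigenvalue_one (hw : 0 ≤ w) (hμ : 0 ≤ μ) (hL : 2 ≤ L) : topEigenvalue w μ 1 L = 0 := by
  have hsqrt (j : Fin L) : √(energySq w μ 1 (momentum L j)) =
      2 * (μ + w) - 2 * w * Real.cos (momentum L j) := by
    have hsq : energySq w μ 1 (momentum L j) =
        (2 * μ + 2 * w * (1 - Real.cos (momentum L j))) ^ 2 := by
      rw [energySq, bandEnergy]
      linear_combination (4 * μ * (μ + 2 * w)) * Real.sin_sq_add_cos_sq (momentum L j)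
    have hcos := sub_nonneg.2 (Real.cos_le_one (momentum L j))
    rw [hsq, Real.sqrt_sq (by positivity)]
    ring
  simp only [topEigenvalue, hsqrt, Finset.sum_sub_distrib, ← Finset.mul_sum, sum_cos_momentum hL,
    Finset.sum_const, Finset.card_univ, Fintype.card_fin, nsmul_eq_mul]
  ring

lemma leadingVector_one (hw : 0 ≤ w) (hμ : 0 < μ) (hL : 2 ≤ L) {η : Config L}
    (hη : Even (numParticles η)) : leadingVector w μ 1 L η = 1 := by
  refine (eq_of_tiltedOp_one_eq_zero hw hμ hL (fun ζ hζ => ?_) hη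
    (even_numParticles_empty L)).trans (leadingVector_empty w μ 1 L)
  rw [tiltedOp_leadingVector hw hμ zero_le_one hL hζ, topEigenvalue_one hw hμ.le hL, zero_mul]

lemma leadingVector_pos_of_nonneg (hw : 0 ≤ w) (hμ : 0 < μ) (hz : 0 ≤ z) (hL : 2 ≤ L)
    (hnonneg : ∀ η, Even (numParticles η) → 0 ≤ leadingVector w μ z L η) {η : Config L}
    (hη : Even (numParticles η)) : 0 < leadingVector w μ z L η := by
  refine (hnonneg η hη).lt_of_ne' fun hzero => one_ne_zero (α := ℝ) ?_
  rw [← leadingVector_empty w μ z L]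
  exact eq_zero_of_tiltedOp_eq hw hμ hz hL hnonneg
    (fun ζ hζ => tiltedOp_leadingVector hw hμ hz hL hζ) hη (even_numParticles_empty L) hzero

/-- The set of tilts `z = exp s` at which the leading eigenvector is positive contains `s = 0`, and
it is open and closed: a nonnegative eigenvector cannot vanish anywhere. -/
theorem leadingVector_exp_pos (hw : 0 ≤ w) (hμ : 0 < μ) (hL : 2 ≤ L) (s : ℝ) {η : Config L}
    (hη : Even (numParticles η)) : 0 < leadingVector w μ (Real.exp s) L η := by
  have hcont (ζ : Config L) : Continuous fun s => leadingVector w μ (Real.exp s) L ζ :=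
    (continuous_leadingVector w μ L ζ).comp Real.continuous_exp
  let positive : Set ℝ :=
    {s | ∀ ζ : Config L, Even (numParticles ζ) → 0 < leadingVector w μ (Real.exp s) L ζ}
  have hpositive : positive =
      {s | ∀ ζ : Config L, Even (numParticles ζ) → 0 ≤ leadingVector w μ (Real.exp s) L ζ} :=
    Set.ext fun s => ⟨fun h ζ hζ => (h ζ hζ).le, fun h ζ hζ =>
      leadingVector_pos_of_nonneg hw hμ (Real.exp_pos s).le hL h hζ⟩
  have hclosed : IsClosed positive := by
    rw [hpositive]
    simp only [Set.ofPred_forall]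
    exact isClosed_iInter fun ζ => isClosed_iInter fun _ => isClosed_le continuous_const (hcont ζ)
  have hopen : IsOpen positive := by
    simp only [positive, Set.ofPred_forall]
    exact isOpen_iInter_of_finite fun ζ => isOpen_iInter_of_finite fun _ =>
      isOpen_lt continuous_const (hcont ζ)
  have huniv : positive = Set.univ := IsClopen.eq_univ ⟨hclosed, hopen⟩
    ⟨0, fun ζ hζ => by rw [Real.exp_zero, leadingVector_one hw hμ hL hζ]; exact one_pos⟩
  exact (huniv ▸ Set.mem_univ s : s ∈ positive) η hη

end PerronFrobenius

section PositiveSemigroups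

/-- A linear operator is quasi-positive on a set `S` of states when adding a multiple of the
identity makes it preserve nonnegativity on `S`, as for generators of positive semigroups. -/
def QuasiPositiveOn {α : Type*} [Fintype α] (T : (α → ℝ) →L[ℝ] (α → ℝ)) (S : Set α) : Prop :=
  ∃ γ : ℝ, ∀ f : α → ℝ, (∀ x ∈ S, 0 ≤ f x) → ∀ x ∈ S, 0 ≤ T f x + γ * f x

lemma hasSum_exp_smul_apply {E : Type*} [NormedAddCommGroup E] [NormedSpace ℝ E] [CompleteSpace E]
    (T : E →L[ℝ] E) (v : E) (t : ℝ) :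
    HasSum (fun n : ℕ => (t ^ n / n.factorial) • (T ^ n) v) (NormedSpace.exp (t • T) v) := by
  have happly := (NormedSpace.exp_series_hasSum_exp' (𝕂 := ℝ) (t • T)).mapL
    (ContinuousLinearMap.apply ℝ E v)
  refine (congrArg (HasSum · _) (funext fun n => ?_)).mpr happly
  rw [ContinuousLinearMap.apply_apply, smul_apply, smul_pow, smul_apply, smul_smul, div_eq_inv_mul]

lemma exp_smul_add_smul_one {A : Type*} [NormedRing A] [NormedAlgebra ℝ A] [CompleteSpace A]
    (T : A) (γ t : ℝ) :
    NormedSpace.exp (t • (T + γ • 1)) = Real.exp (γ * t) • NormedSpace.exp (t • T) := by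
  let _ : NormedAlgebra ℚ A := NormedAlgebra.restrictScalars ℚ ℝ _
  have hsplit : t • (T + γ • 1) = algebraMap ℝ A (γ * t) + t • T := by
    rw [Algebra.algebraMap_eq_smul_one]
    module
  rw [hsplit, NormedSpace.exp_add_of_commute (Algebra.commutes _ _),
    ← NormedSpace.algebraMap_exp_comm, ← Real.exp_eq_exp_ℝ]
  exact (Algebra.smul_def _ _).symm

lemma tendsto_log_div_of_mul_exp_le {u : ℝ → ℝ} {a b r : ℝ} (ha : 0 < a) (hb : 0 < b)
    (hlower : ∀ t, 0 ≤ t → a * Real.exp (r * t) ≤ u t)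
    (hupper : ∀ t, 0 ≤ t → b * u t ≤ Real.exp (r * t)) :
    Tendsto (fun t => Real.log (u t) / t) atTop (𝓝 r) := by
  have hlim (c : ℝ) : Tendsto (fun t : ℝ => c * t⁻¹ + r) atTop (𝓝 r) := by
    simpa using (tendsto_inv_atTop_zero.const_mul c).add_const r
  refine tendsto_of_tendsto_of_tendsto_of_le_of_le' (hlim (Real.log a)) (hlim (-Real.log b)) ?_ ?_
  · filter_upwards [eventually_gt_atTop 0] with t ht
    have hlog := Real.log_le_log (by positivity) (hlower t ht.le)
    rw [Real.log_mul ha.ne' (Real.exp_pos _).ne', Real.log_exp] at hlog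
    rw [le_div_iff₀ ht, add_mul, inv_mul_cancel_right₀ ht.ne']
    exact hlog
  · filter_upwards [eventually_gt_atTop 0] with t ht
    have hu : 0 < u t := (mul_pos ha (Real.exp_pos _)).trans_le (hlower t ht.le)
    have hlog := Real.log_le_log (by positivity) (hupper t ht.le)
    rw [Real.log_mul hb.ne' hu.ne', Real.log_exp] at hlog
    rw [div_le_iff₀ ht, add_mul, inv_mul_cancel_right₀ ht.ne']
    linarith

lemma exists_pos_mul_le {α : Type*} [Finite α] {S : Set α} {f g : α → ℝ} (hf : ∀ x ∈ S, 0 < f x)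
    (hg : ∀ x ∈ S, 0 < g x) : ∃ c, 0 < c ∧ ∀ x ∈ S, c * g x ≤ f x := by
  rcases S.eq_empty_or_nonempty with rfl | hS
  · exact ⟨1, one_pos, fun x hx => hx.elim⟩
  obtain ⟨y, hy, hmin⟩ := Set.exists_min_image S (fun x => f x / g x) S.toFinite hS
  exact ⟨f y / g y, div_pos (hf y hy) (hg y hy), fun x hx => (le_div_iff₀ (hg x hx)).1 (hmin x hx)⟩

namespace QuasiPositiveOn

variable {α : Type*} [Fintype α] {T : (α → ℝ) →L[ℝ] (α → ℝ)} {S : Set α}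

lemma exp_smul_nonneg (hT : QuasiPositiveOn T S) {t : ℝ} (ht : 0 ≤ t) {f : α → ℝ}
    (hf : ∀ x ∈ S, 0 ≤ f x) {x : α} (hx : x ∈ S) : 0 ≤ NormedSpace.exp (t • T) f x := by
  obtain ⟨γ, hγ⟩ := hT
  have hpow (n : ℕ) : ∀ x ∈ S, 0 ≤ ((T + γ • 1) ^ n) f x := by
    induction n with
    | zero => simpa using hf
    | succ n ih =>
      rw [pow_succ']
      simpa [mul_apply_eq_comp] using hγ _ ih
  have hshift : 0 ≤ NormedSpace.exp (t • (T + γ • 1)) f x :=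
    (Pi.hasSum.1 (hasSum_exp_smul_apply (T + γ • 1) f t) x).nonneg fun n =>
      mul_nonneg (by positivity) (hpow n x hx)
  rw [exp_smul_add_smul_one, smul_apply, Pi.smul_apply, smul_eq_mul] at hshift
  exact nonneg_of_mul_nonneg_right hshift (Real.exp_pos _)

lemma exp_smul_mono (hT : QuasiPositiveOn T S) {t : ℝ} (ht : 0 ≤ t) {f g : α → ℝ}
    (hfg : ∀ x ∈ S, f x ≤ g x) {x : α} (hx : x ∈ S) :
    NormedSpace.exp (t • T) f x ≤ NormedSpace.exp (t • T) g x := by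
  have hsub := hT.exp_smul_nonneg ht (f := g - f) (fun y hy => sub_nonneg.2 (hfg y hy)) hx
  rwa [map_sub, Pi.sub_apply, sub_nonneg] at hsub

lemma apply_eq_zero (hT : QuasiPositiveOn T S) {f : α → ℝ} (hf : ∀ x ∈ S, f x = 0) {x : α}
    (hx : x ∈ S) : T f x = 0 := by
  obtain ⟨γ, hγ⟩ := hT
  have hpos := hγ f (fun y hy => (hf y hy).ge) x hx
  have hneg := hγ (-f) (fun y hy => by rw [Pi.neg_apply, hf y hy, neg_zero]) x hx
  rw [map_neg, Pi.neg_apply, Pi.neg_apply, hf x hx] at hneg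
  rw [hf x hx] at hpos
  linarith

lemma pow_apply_of_eigen (hT : QuasiPositiveOn T S) {ψ : α → ℝ} {r : ℝ}
    (hψ : ∀ x ∈ S, T ψ x = r * ψ x) (n : ℕ) : ∀ x ∈ S, (T ^ n) ψ x = r ^ n * ψ x := by
  induction n with
  | zero => simp
  | succ n ih =>
    intro x hx
    have hdiff := hT.apply_eq_zero (f := (T ^ n) ψ - r ^ n • ψ)
      (fun y hy => sub_eq_zero.2 (ih y hy)) hx
    rw [map_sub, map_smul, Pi.sub_apply, sub_eq_zero, Pi.smul_apply, hψ x hx] at hdiff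
    rw [pow_succ', mul_apply_eq_comp, hdiff, smul_eq_mul, pow_succ, mul_assoc]

lemma exp_smul_apply_of_eigen (hT : QuasiPositiveOn T S) {ψ : α → ℝ} {r : ℝ}
    (hψ : ∀ x ∈ S, T ψ x = r * ψ x) (t : ℝ) {x : α} (hx : x ∈ S) :
    NormedSpace.exp (t • T) ψ x = Real.exp (r * t) * ψ x := by
  refine (Pi.hasSum.1 (hasSum_exp_smul_apply T ψ t) x).unique ?_
  have hexp := (NormedSpace.exp_series_hasSum_exp' (𝕂 := ℝ) (r * t)).mul_right (ψ x)
  rw [← Real.exp_eq_exp_ℝ] at hexp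
  refine (congrArg (HasSum · _) (funext fun n => ?_)).mpr hexp
  rw [Pi.smul_apply, hT.pow_apply_of_eigen hψ n x hx, smul_eq_mul, smul_eq_mul, mul_pow]
  ring

theorem tendsto_log_exp_smul_div (hT : QuasiPositiveOn T S) {ψ : α → ℝ} {r : ℝ}
    (hψ : ∀ x ∈ S, T ψ x = r * ψ x) (hψ_pos : ∀ x ∈ S, 0 < ψ x) {f : α → ℝ}
    (hf : ∀ x ∈ S, 0 < f x) {x : α} (hx : x ∈ S) :
    Tendsto (fun t : ℝ => Real.log (NormedSpace.exp (t • T) f x) / t) atTop (𝓝 r) := by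
  obtain ⟨a, ha, hlower⟩ := exists_pos_mul_le hf hψ_pos
  obtain ⟨b, hb, hupper⟩ := exists_pos_mul_le hψ_pos hf
  refine tendsto_log_div_of_mul_exp_le (mul_pos ha (hψ_pos x hx)) (div_pos hb (hψ_pos x hx))
    (fun t ht => ?_) fun t ht => ?_
  · have hmono := hT.exp_smul_mono ht (f := a • ψ) (g := f) hlower hx
    rw [map_smul, Pi.smul_apply, hT.exp_smul_apply_of_eigen hψ t hx, smul_eq_mul] at hmono
    linarith
  · have hmono := hT.exp_smul_mono ht (f := b • f) (g := ψ) hupper hx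
    rw [map_smul, Pi.smul_apply, hT.exp_smul_apply_of_eigen hψ t hx, smul_eq_mul] at hmono
    rwa [div_mul_eq_mul_div, div_le_iff₀ (hψ_pos x hx)]

end QuasiPositiveOn

end PositiveSemigroups

section MomentGeneratingFunction

variable {w μ s : ℝ} {L : ℕ}

lemma exp_mul_natCast_succ (s : ℝ) (a : ℕ) :
    Real.exp (s * (a + 1 : ℕ)) = Real.exp s * Real.exp (s * a) := by
  rw [Nat.cast_succ, mul_add_one, Real.exp_add, mul_comm]

lemma generator_apply (w μ : ℝ) (f : State L → ℝ) (x : State L) :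
    generator w μ L f x = ∑ k : Fin L, (μ * f (flipBond k x.1, x.2)
      + jumpRate w k x.1 * f (flipBond k x.1, x.2 + 1) - (μ + jumpRate w k x.1) * f x) := rfl

lemma generator_exp_mul (w μ s : ℝ) (g : Config L → ℝ) :
    generator w μ L (fun x => Real.exp (s * x.2) * g x.1) =
      fun x => Real.exp (s * x.2) * tiltedOp w μ (Real.exp s) L g x.1 := by
  funext x
  rw [generator_apply, tiltedOp_apply, Finset.mul_sum]
  refine Finset.sum_congr rfl fun k _ => ?_
  rw [exp_mul_natCast_succ]
  ring

lemma generator_pow_exp (w μ s : ℝ) (n : ℕ) :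
    (generator w μ L ^ n) (fun x => Real.exp (s * x.2)) =
      fun x => Real.exp (s * x.2) * (tiltedOp w μ (Real.exp s) L ^ n) (fun _ => 1) x.1 := by
  induction n with
  | zero => simp
  | succ n ih =>
    rw [pow_succ', Module.End.mul_apply, ih, generator_exp_mul, pow_succ', mul_apply_eq_comp]

lemma hasSum_generator {ι : Type*} {f : ι → State L → ℝ} {g : State L → ℝ}
    (hf : ∀ x, HasSum (fun a => f a x) (g x)) (x : State L) :
    HasSum (fun a => generator w μ L (f a) x) (generator w μ L g x) := by
  simp only [generator_apply]
  exact hasSum_sum fun k _ => (((hf (flipBond k x.1, x.2)).mul_left μ).add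
    ((hf (flipBond k x.1, x.2 + 1)).mul_left _)).sub ((hf x).mul_left _)

lemma abs_jumpRate_le (w : ℝ) (k : Fin L) (η : Config L) : |jumpRate w k η| ≤ 2 * |w| := by
  have hocc (j : Fin L) : 0 ≤ occ η j ∧ occ η j ≤ 1 := by
    unfold occ
    split_ifs <;> norm_num
  rw [jumpRate, abs_mul, mul_comm 2, abs_of_nonneg (add_nonneg (hocc _).1 (hocc _).1)]
  have hsum : occ η k + occ η (next k) ≤ 2 := by linarith [(hocc k).2, (hocc (next k)).2]
  exact mul_le_mul_of_nonneg_left hsum (abs_nonneg w)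

lemma abs_generator_apply_le (w μ : ℝ) (f : State L → ℝ) (x : State L) :
    |generator w μ L f x| ≤ ∑ k : Fin L, (|μ| * |f (flipBond k x.1, x.2)|
      + 2 * |w| * |f (flipBond k x.1, x.2 + 1)| + (|μ| + 2 * |w|) * |f x|) := by
  rw [generator_apply]
  refine (Finset.abs_sum_le_sum_abs _ _).trans (Finset.sum_le_sum fun k _ => ?_)
  have hrate := abs_jumpRate_le w k x.1
  refine (abs_sub _ _).trans (add_le_add ((abs_add_le _ _).trans (add_le_add ?_ ?_)) ?_) <;>
    rw [abs_mul] <;> gcongr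
  exact (abs_add_le _ _).trans (by gcongr)

lemma sum_abs_generator_le {ι : Type*} {F : Finset ι} {f : ι → State L → ℝ} {B : ℝ}
    (hf : ∀ x : State L, ∑ a ∈ F, |f a x| ≤ B * Real.exp (s * x.2)) (x : State L) :
    ∑ a ∈ F, |generator w μ L (f a) x| ≤
      (L * (2 * |μ| + 2 * |w| * (Real.exp s + 1)) * B) * Real.exp (s * x.2) := by
  have hbond (k : Fin L) : ∑ a ∈ F, (|μ| * |f a (flipBond k x.1, x.2)|
      + 2 * |w| * |f a (flipBond k x.1, x.2 + 1)| + (|μ| + 2 * |w|) * |f a x|) ≤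
      (2 * |μ| + 2 * |w| * (Real.exp s + 1)) * (B * Real.exp (s * x.2)) := by
    have hjump := hf (flipBond k x.1, x.2 + 1)
    rw [exp_mul_natCast_succ] at hjump
    simp only [Finset.sum_add_distrib, ← Finset.mul_sum]
    calc _ ≤ |μ| * (B * Real.exp (s * x.2))
          + 2 * |w| * (B * (Real.exp s * Real.exp (s * x.2)))
          + (|μ| + 2 * |w|) * (B * Real.exp (s * x.2)) := by
          gcongr
          exacts [hf _, hf x]
      _ = _ := by ring
  calc _ ≤ _ := Finset.sum_le_sum fun a _ => abs_generator_apply_le w μ (f a) x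
    _ = _ := Finset.sum_comm
    _ ≤ ∑ _k : Fin L, (2 * |μ| + 2 * |w| * (Real.exp s + 1)) * (B * Real.exp (s * x.2)) :=
      Finset.sum_le_sum fun k _ => hbond k
    _ = _ := by
      rw [Finset.sum_const, Finset.card_univ, Fintype.card_fin, nsmul_eq_mul]
      ring

/-- The indicator function of activity `a`, weighted by the exponential tilt `exp (s a)`. -/
def tiltedIndicator (L : ℕ) (s : ℝ) (a : ℕ) : State L → ℝ :=
  Real.exp (s * a) • fun x => if x.2 = a then 1 else 0

lemma tiltedIndicator_apply (s : ℝ) (a : ℕ) (x : State L) :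
    tiltedIndicator L s a x = if a = x.2 then Real.exp (s * x.2) else 0 := by
  rcases eq_or_ne a x.2 with rfl | h
  · simp [tiltedIndicator]
  · simp [tiltedIndicator, h, h.symm]

lemma hasSum_generator_pow_tiltedIndicator (w μ s : ℝ) (n : ℕ) : ∀ x : State L,
    HasSum (fun a => (generator w μ L ^ n) (tiltedIndicator L s a) x)
      ((generator w μ L ^ n) (fun x => Real.exp (s * x.2)) x) := by
  induction n with
  | zero =>
    intro x
    simpa [tiltedIndicator_apply] using hasSum_ite_eq x.2 (Real.exp (s * x.2))
  | succ n ih =>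
    simp only [pow_succ', Module.End.mul_apply]
    exact hasSum_generator ih

lemma sum_abs_generator_pow_tiltedIndicator_le (w μ s : ℝ) (F : Finset ℕ) (n : ℕ) :
    ∀ x : State L, ∑ a ∈ F, |(generator w μ L ^ n) (tiltedIndicator L s a) x| ≤
      (L * (2 * |μ| + 2 * |w| * (Real.exp s + 1))) ^ n * Real.exp (s * x.2) := by
  induction n with
  | zero =>
    intro x
    simp only [pow_zero, Module.End.one_apply, tiltedIndicator_apply, apply_ite abs, abs_zero,
      Real.abs_exp, Finset.sum_ite_eq', one_mul]
    split_ifs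
    exacts [le_rfl, (Real.exp_pos _).le]
  | succ n ih =>
    simp only [pow_succ', Module.End.mul_apply]
    exact sum_abs_generator_le ih

lemma tsum_tsum_pow_div_factorial_mul_comm {u : ℕ → ℕ → ℝ} {B : ℝ}
    (hu : ∀ n (F : Finset ℕ), ∑ a ∈ F, |u n a| ≤ B ^ n) (t : ℝ) :
    ∑' a, ∑' n, t ^ n / n.factorial * u n a = ∑' n, t ^ n / n.factorial * ∑' a, u n a := by
  have hrow (n : ℕ) : Summable fun a => |u n a| :=
    summable_of_sum_le (fun _ => abs_nonneg _) (hu n)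
  have habs : Summable fun p : ℕ × ℕ => |t ^ p.1 / p.1.factorial * u p.1 p.2| := by
    refine (summable_prod_of_nonneg fun _ => abs_nonneg _).2 ⟨fun n => ?_, ?_⟩
    · simp only [abs_mul]
      exact (hrow n).mul_left _
    · simp only [abs_mul, tsum_mul_left]
      refine Summable.of_nonneg_of_le (fun n => mul_nonneg (abs_nonneg _)
        (tsum_nonneg fun _ => abs_nonneg _)) (fun n => ?_)
        (Real.summable_pow_div_factorial (|t| * B))
      rw [abs_div, abs_pow, Nat.abs_cast, mul_pow, mul_div_right_comm]
      gcongr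
      exact Real.tsum_le_of_sum_le (fun _ => abs_nonneg _) (hu n)
  have hprod : Summable fun p : ℕ × ℕ => t ^ p.1 / p.1.factorial * u p.1 p.2 := habs.of_abs
  rw [hprod.tsum_comm]
  exact tsum_congr fun n => tsum_mul_left

theorem activityMGF_eq_exp_tiltedOp (w μ s t : ℝ) (η : Config L) :
    activityMGF w μ L η s t = NormedSpace.exp (t • tiltedOp w μ (Real.exp s) L) (fun _ => 1) η := by
  have hbound (n : ℕ) (F : Finset ℕ) :
      ∑ a ∈ F, |(generator w μ L ^ n) (tiltedIndicator L s a) (η, 0)| ≤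
        (L * (2 * |μ| + 2 * |w| * (Real.exp s + 1))) ^ n := by
    simpa using sum_abs_generator_pow_tiltedIndicator_le w μ s F n (η, 0)
  have hrow (n : ℕ) : ∑' a, (generator w μ L ^ n) (tiltedIndicator L s a) (η, 0) =
      (tiltedOp w μ (Real.exp s) L ^ n) (fun _ => 1) η := by
    rw [(hasSum_generator_pow_tiltedIndicator w μ s n (η, 0)).tsum_eq, generator_pow_exp]
    simp
  have hseries : activityMGF w μ L η s t = ∑' a : ℕ, ∑' n : ℕ,
      t ^ n / n.factorial * (generator w μ L ^ n) (tiltedIndicator L s a) (η, 0) := by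
    refine tsum_congr fun a => ?_
    rw [activityProb, semigroup, ← tsum_mul_right]
    refine tsum_congr fun n => ?_
    rw [tiltedIndicator, map_smul, Pi.smul_apply, smul_eq_mul]
    ring
  rw [hseries, tsum_tsum_pow_div_factorial_mul_comm hbound]
  simp only [hrow]
  exact (Pi.hasSum.1 (hasSum_exp_smul_apply (tiltedOp w μ (Real.exp s) L) (fun _ => 1) t)
    η).tsum_eq

end MomentGeneratingFunction

section CumulantGeneratingFunction

variable {w μ z : ℝ} {L : ℕ}

lemma quasiPositiveOn_tiltedOp (hw : 0 ≤ w) (hμ : 0 ≤ μ) (hz : 0 ≤ z) (hL : 2 ≤ L) :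
    QuasiPositiveOn (tiltedOp w μ z L) {η | Even (numParticles η)} := by
  refine ⟨L * (μ + 2 * |w|), fun f hf η hη => ?_⟩
  have hsum : tiltedOp w μ z L f η + L * (μ + 2 * |w|) * f η = ∑ k : Fin L,
      ((μ + z * jumpRate w k η) * f (flipBond k η) + (2 * |w| - jumpRate w k η) * f η) := by
    have hconst : L * (μ + 2 * |w|) * f η = ∑ _k : Fin L, (μ + 2 * |w|) * f η := by
      rw [Finset.sum_const, Finset.card_univ, Fintype.card_fin, nsmul_eq_mul, mul_assoc]
    rw [tiltedOp_apply, hconst, ← Finset.sum_add_distrib]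
    exact Finset.sum_congr rfl fun k _ => by ring
  rw [hsum]
  refine Finset.sum_nonneg fun k _ => add_nonneg (mul_nonneg ?_ ?_) (mul_nonneg ?_ (hf η hη))
  · have := jumpRate_nonneg hw k η
    positivity
  · exact hf _ (even_numParticles_flipBond hL k hη)
  · exact sub_nonneg.2 ((le_abs_self _).trans (abs_jumpRate_le w k η))

/-- The cumulant generating function of the activity in the sector of even particle number, per
site and unit time. -/
def cgf (w μ : ℝ) (L : ℕ) (s : ℝ) : ℝ := topEigenvalue w μ (Real.exp s) L / L

theorem isEvenCGF_cgf (hw : 0 ≤ w) (hμ : 0 < μ) (hL : 2 ≤ L) : IsEvenCGF w μ L (cgf w μ L) := by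
  intro s η hη
  have hz := (Real.exp_pos s).le
  have hlog := (quasiPositiveOn_tiltedOp hw hμ.le hz hL).tendsto_log_exp_smul_div
    (fun ζ hζ => tiltedOp_leadingVector hw hμ hz hL hζ)
    (fun ζ hζ => leadingVector_exp_pos hw hμ hL s hζ) (f := fun _ => 1) (fun _ _ => one_pos) hη
  refine (hlog.div_const (L : ℝ)).congr fun t => ?_
  rw [activityMGF_eq_exp_tiltedOp, div_div, mul_comm t]

lemma energySq_eq (w μ z q : ℝ) :
    energySq w μ z q = 4 * (w ^ 2 * Real.cos q ^ 2 * z ^ 2 + 2 * w * (μ - w * Real.cos q) * z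
      + (μ ^ 2 + w ^ 2 - 2 * w * μ * Real.cos q)) := by
  rw [energySq, bandEnergy, Real.sin_sq]
  ring

lemma energySq_pos (hw : 0 ≤ w) (hμ : 0 < μ) (hz : 0 ≤ z) {q : ℝ} (hq : Real.cos q ≠ 1) :
    0 < energySq w μ z q := by
  rcases eq_or_ne (Real.sin q) 0 with hsin | hsin
  · have hcos : Real.cos q = -1 := (Real.sin_eq_zero_iff_cos_eq.1 hsin).resolve_left hq
    have hsq : energySq w μ z q = (2 * (μ + w * z) + 2 * w) ^ 2 := by
      rw [energySq, bandEnergy, hsin, hcos]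
      ring
    rw [hsq]
    positivity
  · unfold energySq
    positivity

/-- Half the derivative of the squared energy with respect to `s = log z`. -/
def energySlope (w μ q z : ℝ) : ℝ :=
  4 * (w ^ 2 * Real.cos q ^ 2 * z ^ 2 + w * (μ - w * Real.cos q) * z)

/-- The second derivative of the energy with respect to `s = log z`. -/
def energyCurv (w μ q z : ℝ) : ℝ :=
  (energySlope w μ q z + 4 * (w ^ 2 * Real.cos q ^ 2 * z ^ 2)) / √(energySq w μ z q)
    - energySlope w μ q z ^ 2 / √(energySq w μ z q) ^ 3

lemma hasDerivAt_quadratic_exp (a b c s : ℝ) :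
    HasDerivAt (fun s => a * Real.exp s ^ 2 + b * Real.exp s + c)
      (2 * (a * Real.exp s ^ 2) + b * Real.exp s) s := by
  have hexp := Real.hasDerivAt_exp s
  refine ((((hexp.pow 2).const_mul a).add (hexp.const_mul b)).add_const c).congr_deriv ?_
  ring

lemma hasDerivAt_sqrt_energySq (hw : 0 ≤ w) (hμ : 0 < μ) {q : ℝ} (hq : Real.cos q ≠ 1) (s : ℝ) :
    HasDerivAt (fun s => √(energySq w μ (Real.exp s) q))
      (energySlope w μ q (Real.exp s) / √(energySq w μ (Real.exp s) q)) s := by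
  have hsq : HasDerivAt (fun s => energySq w μ (Real.exp s) q)
      (2 * energySlope w μ q (Real.exp s)) s := by
    simp only [energySq_eq]
    refine ((hasDerivAt_quadratic_exp _ _ _ s).const_mul 4).congr_deriv ?_
    rw [energySlope]
    ring
  refine (hsq.sqrt (energySq_pos hw hμ (Real.exp_pos s).le hq).ne').congr_deriv ?_
  rw [mul_div_mul_left _ _ two_ne_zero]

lemma hasDerivAt_energySlope_div (hw : 0 ≤ w) (hμ : 0 < μ) {q : ℝ} (hq : Real.cos q ≠ 1)
    (s : ℝ) :
    HasDerivAt (fun s => energySlope w μ q (Real.exp s) / √(energySq w μ (Real.exp s) q))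
      (energyCurv w μ q (Real.exp s)) s := by
  have hpos := Real.sqrt_pos.2 (energySq_pos hw hμ (Real.exp_pos s).le hq)
  have hslope : HasDerivAt (fun s => energySlope w μ q (Real.exp s))
      (energySlope w μ q (Real.exp s) + 4 * (w ^ 2 * Real.cos q ^ 2 * Real.exp s ^ 2)) s := by
    simp only [energySlope]
    refine (((hasDerivAt_quadratic_exp (w ^ 2 * Real.cos q ^ 2) (w * (μ - w * Real.cos q)) 0
      s).const_mul 4).congr_of_eventuallyEq (.of_forall fun s => by ring)).congr_deriv ?_
    ring
  refine (hslope.div (hasDerivAt_sqrt_energySq hw hμ hq s) hpos.ne').congr_deriv ?_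
  rw [energyCurv]
  field_simp

lemma contDiff_cgf (hw : 0 ≤ w) (hμ : 0 < μ) (L : ℕ) (n : WithTop ℕ∞) :
    ContDiff ℝ n (cgf w μ L) := by
  have henergy (j : Fin L) :
      ContDiff ℝ n fun s => √(energySq w μ (Real.exp s) (momentum L j)) := by
    refine ContDiff.sqrt ?_ fun s =>
      (energySq_pos hw hμ (Real.exp_pos s).le (cos_momentum_ne_one j)).ne'
    unfold energySq bandEnergy
    fun_prop
  unfold cgf topEigenvalue
  exact (contDiff_const.add (contDiff_const.mul (ContDiff.sum fun j _ => henergy j))).div_const _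

/-- The second derivative of the cumulant generating function, in the variable `z = exp s`. -/
def secondCumulant (w μ : ℝ) (L : ℕ) (z : ℝ) : ℝ :=
  1 / 2 * (∑ j : Fin L, energyCurv w μ (momentum L j) z) / L

lemma iteratedDeriv_two_cgf (hw : 0 ≤ w) (hμ : 0 < μ) (L : ℕ) (s : ℝ) :
    iteratedDeriv 2 (cgf w μ L) s = secondCumulant w μ L (Real.exp s) := by
  have hderiv : deriv (cgf w μ L) = fun s => 1 / 2 * (∑ j : Fin L,
      energySlope w μ (momentum L j) (Real.exp s) /
        √(energySq w μ (Real.exp s) (momentum L j))) / L := funext fun s =>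
    ((((HasDerivAt.fun_sum fun (j : Fin L) _ =>
      hasDerivAt_sqrt_energySq hw hμ (cos_momentum_ne_one j) s).const_mul (1 / 2)).const_add
        _).div_const _).deriv
  rw [iteratedDeriv_succ, iteratedDeriv_one, hderiv]
  exact (((HasDerivAt.fun_sum fun (j : Fin L) _ =>
    hasDerivAt_energySlope_div hw hμ (cos_momentum_ne_one j) s).const_mul (1 / 2)).div_const
      _).deriv

lemma secondCumulant_zero (w μ : ℝ) (L : ℕ) : secondCumulant w μ L 0 = 0 := by
  simp [secondCumulant, energyCurv, energySlope]

lemma continuousAt_energyCurv (hw : 0 ≤ w) (hμ : 0 < μ) (hz : 0 ≤ z) {q : ℝ}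
    (hq : Real.cos q ≠ 1) : ContinuousAt (energyCurv w μ q) z := by
  have hpos := Real.sqrt_pos.2 (energySq_pos hw hμ hz hq)
  have henergy : ContinuousAt (fun z => √(energySq w μ z q)) z := by
    unfold energySq bandEnergy
    fun_prop
  unfold energyCurv energySlope
  exact ((by fun_prop : ContinuousAt _ z).div₀ henergy hpos.ne').sub
    ((by fun_prop : ContinuousAt _ z).div₀ (henergy.pow 3) (pow_pos hpos 3).ne')

lemma tendsto_iteratedDeriv_two_cgf_atBot (hw : 0 ≤ w) (hμ : 0 < μ) (L : ℕ) :
    Tendsto (iteratedDeriv 2 (cgf w μ L)) atBot (𝓝 0) := by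
  have hcont : ContinuousAt (secondCumulant w μ L) 0 := by
    unfold secondCumulant
    exact ((tendsto_finsetSum Finset.univ fun j _ => continuousAt_energyCurv hw hμ le_rfl
      (cos_momentum_ne_one j)).const_mul (1 / 2)).div_const _
  have hlim := hcont.tendsto.comp Real.tendsto_exp_atBot
  rw [secondCumulant_zero] at hlim
  exact hlim.congr fun s => (iteratedDeriv_two_cgf hw hμ L s).symm

end CumulantGeneratingFunction

section CriticalPoint

variable {w ν : ℝ}

lemma sqrt_energySq_critical (hw : 0 ≤ w) (ν q : ℝ) :
    √(energySq w (w * (1 - ν)) ν q) =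
      2 * w * (√(1 - Real.cos q) * √(2 * (1 - ν ^ 2) + ν ^ 2 * (1 - Real.cos q))) := by
  have hfactor : energySq w (w * (1 - ν)) ν q = (2 * w) ^ 2 *
      ((1 - Real.cos q) * (2 * (1 - ν ^ 2) + ν ^ 2 * (1 - Real.cos q))) := by
    rw [energySq_eq]
    ring
  rw [hfactor, Real.sqrt_mul (sq_nonneg _), Real.sqrt_sq (by positivity),
    Real.sqrt_mul (sub_nonneg.2 (Real.cos_le_one q))]

/-- The bounded part of the critical curvature of a mode, as a function of `u = 1 - cos q`. -/
def curvRemainder (ν u : ℝ) : ℝ :=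
  (ν * (1 - 2 * ν + ν * u) + ν ^ 2 * (u - 2)) / √(2 * (1 - ν ^ 2) + ν ^ 2 * u)
    - (ν * (1 - 2 * ν + ν * u)) ^ 2 / √(2 * (1 - ν ^ 2) + ν ^ 2 * u) ^ 3
    - ν ^ 4 / (√(2 * (1 - ν ^ 2) + ν ^ 2 * u) * √(2 * (1 - ν ^ 2)) *
      (√(2 * (1 - ν ^ 2) + ν ^ 2 * u) + √(2 * (1 - ν ^ 2))))

lemma critical_curv_split {x r r₀ : ℝ} (a : ℝ) (hw : w ≠ 0) (hx : 0 < x) (hr : 0 < r)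
    (hr₀ : 0 < r₀) (hsq : r ^ 2 - r₀ ^ 2 = ν ^ 2 * x ^ 2) :
    (4 * w ^ 2 * x ^ 2 * a + 4 * (w ^ 2 * (1 - x ^ 2) ^ 2 * ν ^ 2)) / (2 * w * (x * r))
        - (4 * w ^ 2 * x ^ 2 * a) ^ 2 / (2 * w * (x * r)) ^ 3
      = 2 * w * (ν ^ 2 / (x * r₀) + x * ((a + ν ^ 2 * (x ^ 2 - 2)) / r - a ^ 2 / r ^ 3
        - ν ^ 4 / (r * r₀ * (r + r₀)))) := by
  have hadd : r + r₀ ≠ 0 := by positivity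
  have hinv : 1 / r = 1 / r₀ - ν ^ 2 * x ^ 2 / (r * r₀ * (r + r₀)) := by
    rw [← hsq]
    field_simp
    ring
  calc _ = 2 * w * (ν ^ 2 / x * (1 / r)
        + x * ((a + ν ^ 2 * (x ^ 2 - 2)) / r - a ^ 2 / r ^ 3)) := by
        field_simp
        ring
    _ = _ := by
        rw [hinv]
        field_simp
        ring

lemma energyCurv_critical (hw : 0 < w) (hν0 : 0 ≤ ν) (hν1 : ν < 1) {q : ℝ}
    (hq : Real.cos q ≠ 1) :
    energyCurv w (w * (1 - ν)) q ν = 2 * w * (ν ^ 2 / (√(1 - Real.cos q) * √(2 * (1 - ν ^ 2)))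
      + √(1 - Real.cos q) * curvRemainder ν (1 - Real.cos q)) := by
  obtain ⟨u, hu⟩ : ∃ u, u = 1 - Real.cos q := ⟨_, rfl⟩
  have hcos : Real.cos q = 1 - u := by rw [hu, sub_sub_cancel]
  have hu0 : 0 < u := by
    rw [hu]
    exact sub_pos.2 (lt_of_le_of_ne (Real.cos_le_one q) hq)
  have hp₀ : 0 < 2 * (1 - ν ^ 2) := by nlinarith
  have hp : 0 < 2 * (1 - ν ^ 2) + ν ^ 2 * u := by positivity
  have hslope : energySlope w (w * (1 - ν)) q ν =
      4 * w ^ 2 * u * (ν * (1 - 2 * ν + ν * u)) := by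
    rw [energySlope, hcos]
    ring
  have hsplit := critical_curv_split (ν * (1 - 2 * ν + ν * u)) hw.ne' (Real.sqrt_pos.2 hu0)
    (Real.sqrt_pos.2 hp) (Real.sqrt_pos.2 hp₀) (ν := ν) (by
      rw [Real.sq_sqrt hp.le, Real.sq_sqrt hp₀.le, Real.sq_sqrt hu0.le]
      ring)
  rw [Real.sq_sqrt hu0.le] at hsplit
  rw [energyCurv, sqrt_energySq_critical hw.le, hslope, curvRemainder, ← hu, hcos]
  exact hsplit

lemma exists_curvRemainder_bound (hν0 : 0 ≤ ν) (hν1 : ν < 1) :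
    ∃ C, ∀ u ∈ Set.Icc (0 : ℝ) 2, ‖curvRemainder ν u‖ ≤ C := by
  have hp₀ : 0 < 2 * (1 - ν ^ 2) := by nlinarith
  refine isCompact_Icc.exists_bound_of_continuousOn fun u hu => ContinuousAt.continuousWithinAt ?_
  have hr : 0 < √(2 * (1 - ν ^ 2) + ν ^ 2 * u) :=
    Real.sqrt_pos.2 (add_pos_of_pos_of_nonneg hp₀ (mul_nonneg (sq_nonneg ν) hu.1))
  have hcont : ContinuousAt (fun u : ℝ => √(2 * (1 - ν ^ 2) + ν ^ 2 * u)) u := by fun_prop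
  unfold curvRemainder
  exact ((ContinuousAt.div₀ (by fun_prop) hcont hr.ne').sub
    (ContinuousAt.div₀ (by fun_prop) (hcont.pow 3) (pow_pos hr 3).ne')).sub
    (ContinuousAt.div₀ (by fun_prop) (by fun_prop) (by positivity))

lemma exists_energyCurv_bound (hw : 0 < w) (hν0 : 0 ≤ ν) (hν1 : ν < 1) :
    ∃ C, ∀ q, Real.cos q ≠ 1 → |energyCurv w (w * (1 - ν)) q ν
      - 2 * w * (ν ^ 2 / (√(1 - Real.cos q) * √(2 * (1 - ν ^ 2))))| ≤ C := by
  obtain ⟨C, hC⟩ := exists_curvRemainder_bound hν0 hν1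
  refine ⟨2 * w * (√2 * C), fun q hq => ?_⟩
  have hle := Real.cos_le_one q
  have hge := Real.neg_one_le_cos q
  rw [energyCurv_critical hw hν0 hν1 hq, ← mul_sub, add_sub_cancel_left, abs_mul,
    abs_of_pos (by positivity : 0 < 2 * w), abs_mul, abs_of_nonneg (Real.sqrt_nonneg _)]
  gcongr
  · linarith
  · exact hC _ ⟨by linarith, by linarith⟩

lemma sqrt_one_sub_cos {q : ℝ} (hq0 : 0 ≤ q) (hq : q ≤ 2 * Real.pi) :
    √(1 - Real.cos q) = √2 * Real.sin (q / 2) := by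
  have hsin : 0 ≤ Real.sin (q / 2) :=
    Real.sin_nonneg_of_nonneg_of_le_pi (by linarith) (by linarith)
  have hsq : 1 - Real.cos q = 2 * Real.sin (q / 2) ^ 2 := by
    rw [Real.sin_sq_eq_half_sub, mul_div_cancel₀ _ two_ne_zero]
    ring
  rw [hsq, Real.sqrt_mul zero_le_two, Real.sqrt_sq hsin]

end CriticalPoint

section ReciprocalSine

lemma mul_cos_le_sin {x : ℝ} (hx0 : 0 ≤ x) (hx : x ≤ Real.pi / 2) :
    x * Real.cos x ≤ Real.sin x := by
  rcases hx.lt_or_eq with hlt | rfl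
  · have hcos : 0 < Real.cos x := Real.cos_pos_of_mem_Ioo ⟨by linarith [Real.pi_pos], hlt⟩
    rw [← le_div_iff₀ hcos, ← Real.tan_eq_sin_div_cos]
    exact Real.le_tan hx0 hlt
  · simp

lemma inv_sin_sub_inv_le_one {x : ℝ} (hx0 : 0 < x) (hx : x ≤ Real.pi / 2) :
    (Real.sin x)⁻¹ - x⁻¹ ≤ 1 := by
  have hsin : 0 < Real.sin x := Real.sin_pos_of_pos_of_lt_pi hx0 (by linarith)
  have hcos : 0 ≤ Real.cos x := Real.cos_nonneg_of_neg_pi_div_two_le_of_le (by linarith) hx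
  calc (Real.sin x)⁻¹ - x⁻¹ ≤ (Real.sin x)⁻¹ - Real.cos x / Real.sin x := by
        gcongr
        rw [div_le_iff₀ hsin, inv_mul_eq_div, le_div_iff₀ hx0, mul_comm]
        exact mul_cos_le_sin hx0.le hx
    _ ≤ 1 := by
        rw [inv_eq_one_div, ← sub_div, div_le_one hsin]
        nlinarith [Real.sin_sq_add_cos_sq x, Real.sin_le_one x, Real.cos_le_one x]

lemma abs_inv_sin_sub_le_one_of_le {x : ℝ} (hx0 : 0 < x) (hx : x ≤ Real.pi / 2) :
    |(Real.sin x)⁻¹ - (x⁻¹ + (Real.pi - x)⁻¹)| ≤ 1 := by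
  have hsin : 0 < Real.sin x := Real.sin_pos_of_pos_of_lt_pi hx0 (by linarith)
  have hinv : x⁻¹ ≤ (Real.sin x)⁻¹ := inv_anti₀ hsin (Real.sin_le hx0.le)
  have hupper := inv_sin_sub_inv_le_one hx0 hx
  have hreflect_pos : 0 < (Real.pi - x)⁻¹ := inv_pos.2 (by linarith)
  have hreflect_le : (Real.pi - x)⁻¹ ≤ 1 :=
    inv_le_one_of_one_le₀ (by linarith [Real.pi_gt_three])
  rw [abs_le]
  constructor <;> linarith

lemma abs_inv_sin_sub_le_one {x : ℝ} (hx0 : 0 < x) (hx : x < Real.pi) :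
    |(Real.sin x)⁻¹ - (x⁻¹ + (Real.pi - x)⁻¹)| ≤ 1 := by
  rcases le_total x (Real.pi / 2) with hle | hge
  · exact abs_inv_sin_sub_le_one_of_le hx0 hle
  · have hreflect := abs_inv_sin_sub_le_one_of_le (x := Real.pi - x) (by linarith) (by linarith)
    rwa [Real.sin_pi_sub, sub_sub_cancel, add_comm] at hreflect

lemma sum_inv_odd (n : ℕ) :
    ∑ j ∈ Finset.range n, (2 * (j : ℝ) + 1)⁻¹ = harmonic (2 * n) - 1 / 2 * harmonic n := by
  induction n with
  | zero => simp
  | succ n ih =>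
    rw [Finset.sum_range_succ, ih, mul_add_one, harmonic_succ, harmonic_succ, harmonic_succ]
    push_cast
    field_simp
    ring

lemma abs_harmonic_sub_log_le_one {n : ℕ} (hn : n ≠ 0) : |(harmonic n : ℝ) - Real.log n| ≤ 1 := by
  have hlog : Real.log n ≤ Real.log (n + 1) := Real.log_le_log (by positivity) (by linarith)
  have hlower := log_add_one_le_harmonic n
  have hupper := harmonic_le_one_add_log n
  push_cast at hlower
  rw [abs_le]
  constructor <;> linarith

lemma abs_sum_inv_odd_sub_le {n : ℕ} (hn : n ≠ 0) :
    |∑ j ∈ Finset.range n, (2 * (j : ℝ) + 1)⁻¹ - 1 / 2 * Real.log n| ≤ 5 / 2 := by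
  have hdouble := abs_le.1 (abs_harmonic_sub_log_le_one (mul_ne_zero two_ne_zero hn))
  have hsingle := abs_le.1 (abs_harmonic_sub_log_le_one hn)
  rw [Nat.cast_mul, Nat.cast_ofNat, Real.log_mul two_ne_zero (Nat.cast_ne_zero.2 hn)] at hdouble
  have hlog_two_pos := Real.log_pos one_lt_two
  have hlog_two_le := Real.log_two_lt_d9
  rw [sum_inv_odd, abs_le]
  constructor <;> linarith

variable {L : ℕ}

lemma sum_inv_half_momentum_add (hL : L ≠ 0) :
    (∑ j : Fin L, ((momentum L j / 2)⁻¹ + (Real.pi - momentum L j / 2)⁻¹)) / L =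
      4 / Real.pi * ∑ j ∈ Finset.range L, (2 * (j : ℝ) + 1)⁻¹ := by
  have hreflect : ∑ j : Fin L, (Real.pi - momentum L j / 2)⁻¹ =
      ∑ j : Fin L, (momentum L j / 2)⁻¹ := by
    rw [← Equiv.sum_comp Fin.revPerm]
    refine Finset.sum_congr rfl fun j _ => ?_
    rw [Fin.revPerm_apply, momentum_rev, sub_div, mul_div_cancel_left₀ _ two_ne_zero,
      sub_sub_cancel]
  rw [Finset.sum_add_distrib, hreflect, ← two_mul, mul_div_right_comm,
    ← Fin.sum_univ_eq_sum_range (fun j => (2 * (j : ℝ) + 1)⁻¹) L, Finset.mul_sum, Finset.mul_sum]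
  refine Finset.sum_congr rfl fun j _ => ?_
  rw [momentum]
  have hL' : (L : ℝ) ≠ 0 := Nat.cast_ne_zero.2 hL
  field_simp
  ring

lemma abs_sum_div_sub_sum_div_le {f g : Fin L → ℝ} {C : ℝ} (hL : L ≠ 0)
    (hfg : ∀ j, |f j - g j| ≤ C) : |(∑ j, f j) / L - (∑ j, g j) / L| ≤ C := by
  have hL' : (0 : ℝ) < L := Nat.cast_pos.2 (Nat.pos_of_ne_zero hL)
  rw [← sub_div, ← Finset.sum_sub_distrib, abs_div, abs_of_pos hL', div_le_iff₀ hL']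
  calc |∑ j, (f j - g j)| ≤ ∑ j, |f j - g j| := Finset.abs_sum_le_sum_abs _ _
    _ ≤ ∑ _j : Fin L, C := Finset.sum_le_sum fun j _ => hfg j
    _ = C * L := by simp [mul_comm]

lemma abs_sum_inv_sin_sub_le (hL : L ≠ 0) :
    |(∑ j : Fin L, (Real.sin (momentum L j / 2))⁻¹) / L - 2 / Real.pi * Real.log L| ≤ 5 := by
  have hsin : |(∑ j : Fin L, (Real.sin (momentum L j / 2))⁻¹) / L
      - 4 / Real.pi * ∑ j ∈ Finset.range L, (2 * (j : ℝ) + 1)⁻¹| ≤ 1 := by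
    rw [← sum_inv_half_momentum_add hL]
    exact abs_sum_div_sub_sum_div_le hL fun j => abs_inv_sin_sub_le_one
      (half_pos (momentum_pos j)) (by linarith [momentum_lt_two_pi j])
  have hodd : |4 / Real.pi * ∑ j ∈ Finset.range L, (2 * (j : ℝ) + 1)⁻¹
      - 2 / Real.pi * Real.log L| ≤ 4 := by
    have hpi : 4 / Real.pi ≤ 8 / 5 := by
      rw [div_le_div_iff₀ Real.pi_pos (by norm_num)]
      linarith [Real.pi_gt_three]
    calc _ = |4 / Real.pi * (∑ j ∈ Finset.range L, (2 * (j : ℝ) + 1)⁻¹ - 1 / 2 * Real.log L)| := by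
          congr 1
          ring
      _ ≤ 8 / 5 * (5 / 2) := by
          rw [abs_mul, abs_of_pos (by positivity)]
          gcongr
          exact abs_sum_inv_odd_sub_le hL
      _ = 4 := by norm_num
  linarith [abs_sub_le ((∑ j : Fin L, (Real.sin (momentum L j / 2))⁻¹) / L)
    (4 / Real.pi * ∑ j ∈ Finset.range L, (2 * (j : ℝ) + 1)⁻¹) (2 / Real.pi * Real.log L)]

end ReciprocalSine

section CriticalVariance

variable {w ν : ℝ}

lemma exists_secondCumulant_bound (hw : 0 < w) (hν0 : 0 ≤ ν) (hν1 : ν < 1) :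
    ∃ C, ∀ L : ℕ, L ≠ 0 → |secondCumulant w (w * (1 - ν)) L ν
      - w * ν ^ 2 / (Real.pi * √(1 - ν ^ 2)) * Real.log L| ≤ C := by
  obtain ⟨C, hC⟩ := exists_energyCurv_bound hw hν0 hν1
  set A := w * ν ^ 2 / √(1 - ν ^ 2) with hA
  have hA0 : 0 ≤ A := by positivity
  have hmode (q : ℝ) (hq0 : 0 ≤ q) (hq : q ≤ 2 * Real.pi) :
      2 * w * (ν ^ 2 / (√(1 - Real.cos q) * √(2 * (1 - ν ^ 2)))) = A * (Real.sin (q / 2))⁻¹ := by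
    have hsqrt_two : √2 * Real.sin (q / 2) * (√2 * √(1 - ν ^ 2)) =
        2 * (Real.sin (q / 2) * √(1 - ν ^ 2)) := by
      rw [mul_mul_mul_comm, Real.mul_self_sqrt zero_le_two]
    rw [sqrt_one_sub_cos hq0 hq, Real.sqrt_mul zero_le_two, hsqrt_two, mul_div_assoc', mul_assoc 2,
      mul_div_mul_left _ _ two_ne_zero, hA, ← div_eq_mul_inv, div_div, mul_comm (Real.sin _)]
  refine ⟨1 / 2 * C + 1 / 2 * A * 5, fun L hL => ?_⟩
  have hcurv : |(∑ j : Fin L, energyCurv w (w * (1 - ν)) (momentum L j) ν) / L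
      - (∑ j : Fin L, A * (Real.sin (momentum L j / 2))⁻¹) / L| ≤ C :=
    abs_sum_div_sub_sum_div_le hL fun j => by
      rw [← hmode _ (momentum_pos j).le (momentum_lt_two_pi j).le]
      exact hC _ (cos_momentum_ne_one j)
  have hsin := abs_sum_inv_sin_sub_le hL
  rw [← Finset.mul_sum, mul_div_assoc] at hcurv
  generalize (∑ j : Fin L, (Real.sin (momentum L j / 2))⁻¹) / L = S at hcurv hsin
  rw [secondCumulant, mul_div_assoc]
  generalize (∑ j : Fin L, energyCurv w (w * (1 - ν)) (momentum L j) ν) / L = X at hcurv ⊢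
  calc _ = |1 / 2 * (X - A * S) + 1 / 2 * A * (S - 2 / Real.pi * Real.log L)| := by
        rw [hA]
        congr 1
        field_simp
        ring
    _ ≤ |1 / 2 * (X - A * S)| + |1 / 2 * A * (S - 2 / Real.pi * Real.log L)| := abs_add_le _ _
    _ ≤ 1 / 2 * C + 1 / 2 * A * 5 := by
        rw [abs_mul (1 / 2), abs_mul (1 / 2 * A), abs_of_pos one_half_pos,
          abs_of_nonneg (mul_nonneg one_half_pos.le hA0)]
        gcongr

lemma isEquivalent_of_abs_sub_le {α : Type*} {l : Filter α} {u v : α → ℝ} {C : ℝ}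
    (hv : Tendsto v l atTop) (h : ∀ᶠ a in l, |u a - v a| ≤ C) : u ~[l] v := by
  have hbounded : (u - v) =O[l] fun _ => (1 : ℝ) :=
    IsBigO.of_bound C (h.mono fun a ha => by simpa using ha)
  refine hbounded.trans_isLittleO ?_
  rw [isLittleO_one_left_iff]
  exact tendsto_norm_atTop_atTop.comp hv

lemma tendsto_const_mul_log_atTop {c : ℝ} (hc : 0 < c) :
    Tendsto (fun L : ℕ => c * Real.log L) atTop atTop :=
  (Real.tendsto_log_atTop.comp tendsto_natCast_atTop_atTop).const_mul_atTop hc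

lemma critical_coeff_pos (hw : 0 < w) (hν0 : 0 < ν) (hν1 : ν < 1) :
    0 < w * ν ^ 2 / (Real.pi * √(1 - ν ^ 2)) := by
  have hsqrt : 0 < √(1 - ν ^ 2) := Real.sqrt_pos.2 (by nlinarith)
  exact div_pos (by positivity) (mul_pos Real.pi_pos hsqrt)

theorem secondCumulant_critical_isEquivalent (hw : 0 < w) (hν0 : 0 ≤ ν) (hν1 : ν < 1) :
    (fun L => secondCumulant w (w * (1 - ν)) L ν) ~[atTop]
      fun L : ℕ => w * ν ^ 2 / (Real.pi * √(1 - ν ^ 2)) * Real.log L := by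
  rcases hν0.eq_or_lt with rfl | hν
  · simpa [secondCumulant_zero] using IsEquivalent.refl
  · obtain ⟨C, hC⟩ := exists_secondCumulant_bound hw hν0 hν1
    exact isEquivalent_of_abs_sub_le (tendsto_const_mul_log_atTop (critical_coeff_pos hw hν hν1))
      ((eventually_ne_atTop 0).mono hC)

end CriticalVariance

end DLPAD

end

theorem mainTheorem5_general (w : ℝ) (hw : 0 < w) (ν : ℝ) (hν0 : 0 ≤ ν) (hν1 : ν < 1) :
    ∃ (K : ℕ → ℝ → ℝ) (V : ℕ → ℝ),
      (∀ L : ℕ, 2 ≤ L →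
        DLPAD.IsEvenCGF w (w * (1 - ν)) L (K L) ∧
        ContDiff ℝ 2 (K L) ∧
        (0 < ν → V L = iteratedDeriv 2 (K L) (Real.log ν)) ∧
        (ν = 0 → Tendsto (iteratedDeriv 2 (K L)) atBot (𝓝 (V L)))) ∧
      (V ~[atTop] fun L : ℕ => w * ν ^ 2 / (Real.pi * √(1 - ν ^ 2)) * Real.log L) ∧
      (0 < ν → Tendsto V atTop atTop) := by
  have hμ : 0 < w * (1 - ν) := mul_pos hw (sub_pos.2 hν1)
  have hequiv := DLPAD.secondCumulant_critical_isEquivalent hw hν0 hν1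
  refine ⟨DLPAD.cgf w (w * (1 - ν)), fun L => DLPAD.secondCumulant w (w * (1 - ν)) L ν,
    fun L hL => ⟨DLPAD.isEvenCGF_cgf hw.le hμ hL, DLPAD.contDiff_cgf hw.le hμ L 2, fun hν => ?_,
      ?_⟩, hequiv, fun hν => hequiv.symm.tendsto_atTop
        (DLPAD.tendsto_const_mul_log_atTop (DLPAD.critical_coeff_pos hw hν hν1))⟩
  · rw [DLPAD.iteratedDeriv_two_cgf hw.le hμ, Real.exp_log hν]
  · rintro rfl
    simpa only [DLPAD.secondCumulant_zero] using
      DLPAD.tendsto_iteratedDeriv_two_cgf_atBot hw.le hμ L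

/-- The critical variance of the activity. The jump rate is `w = 1/2` and the deposition rate is
`μ = (1 - ν)/2`, so that `ν = 1 - μ / w`; the critical point is `s_c = log ν`, with `s_c = -∞`
for `ν = 0`, where the critical variance is the limit of the second cumulant as `s → -∞`. -/
theorem mainTheorem5 (ν : ℝ) (hν0 : 0 ≤ ν) (hν1 : ν < 1) :
    ∃ (K : ℕ → ℝ → ℝ) (V : ℕ → ℝ),
      (∀ L : ℕ, 2 ≤ L →
        DLPAD.IsEvenCGF (1 / 2) ((1 - ν) / 2) L (K L) ∧
        ContDiff ℝ 2 (K L) ∧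
        (0 < ν → V L = iteratedDeriv 2 (K L) (Real.log ν)) ∧
        (ν = 0 → Tendsto (iteratedDeriv 2 (K L)) atBot (𝓝 (V L)))) ∧
      (V ~[atTop] fun L : ℕ =>
        ν ^ 2 / (2 * Real.pi * Real.sqrt (1 - ν ^ 2)) * Real.log L) ∧
      (0 < ν → Tendsto V atTop atTop) := by
  have hμ : (1 - ν) / 2 = 1 / 2 * (1 - ν) := by ring
  have hcoeff : ν ^ 2 / (2 * Real.pi * √(1 - ν ^ 2)) =
      1 / 2 * ν ^ 2 / (Real.pi * √(1 - ν ^ 2)) := by ring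
  simpa only [hμ, hcoeff] using mainTheorem5_general (1 / 2) one_half_pos ν hν0 hν1
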